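/- Let $F$ be a non-archimedean local field with ring of integers $\mathcal{O}$, maximal ideal $\mathfrak{p}$ and residue field of order $q$. Let $G=GL(2,F)$, let $Z$ be its centre, $B$ its subgroup of upper triangular matrices, $K=GL(2,\mathcal{O})$, and let $$I=\left\{\begin{pmatrix} a & b\\ c& d\end{pmatrix}\in G : a,d\in\mathcal{O}^\times,\ b\in\mathcal{O},\ c\in\mathfrak{p}\right\}$$ be the Iwahori subgroup. Let $\mathrm{Ind}_B^G \mathbb{1}$ be the space of functions $f:G\to\mathbb{C}$ with $f(bg)=f(g)$ for all $b\in B$, $g\in G$ that are right invariant under some compact open subgroup of $G$ (depending on $f$), on which $G$ acts by right translation. The Steinberg representation $(\pi,V)=\mathrm{St}_G$ is the quotient of $\mathrm{Ind}_B^G\mathbb{1}$ by the line of constant functions. Let $\check V$ be its smooth dual, that is, the space of linear functionals on $V$ that are fixed by some compact open subgroup of $G$ under the dual action $\langle\check\pi(g)\check v,v\rangle=\langle\check v,\pi(g^{-1})v\rangle$. Given a Haar measure $\mu$ on $G/Z$, the formal dimension of $\pi$ is the positive real number $d_\pi$ for which $$\int_{G/Z}\langle\check\pi(g)\check v,v\rangle\,\langle\check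 v',\pi(g)v'\rangle\,d\mu(g)=d_\pi^{-1}\,\langle\check v,v'\rangle\,\langle\check v',v\rangle\qquad(v,v'\in V,\ \check v,\check v'\in\check V),$$ the matrix coefficients $g\mapsto\langle\check v,\pi(g)v\rangle$ being square-integrable on $G/Z$. Then the formal dimension of the Steinberg representation exists, is unique, and has the following value. (i) If $\mu(I.Z/Z)=1$, it is $\dfrac{q-1}{2(q+1)}$. (ii) If $\mu(K.Z/Z)=1$, it is $\dfrac{q-1}{2}$. -/

import Mathlib

open MeasureTheory ValuativeRel

noncomputable section

section SmoothRepresentations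

variable {G : Type*} [Group G] [TopologicalSpace G] [IsTopologicalGroup G]

/-- The subspace `⋃ V^U` of smooth vectors of a complex representation `(π, V)`, the union being
over the open subgroups `U` of `G`. In a locally profinite group every open subgroup contains a
compact open one, so it is the same to let `U` range over the compact open subgroups. -/
def smoothVectors {V : Type*} [AddCommGroup V] [Module ℂ V] (π : Representation ℂ G V) :
    Submodule ℂ V where
  carrier := {v | ∃ U : Subgroup G, IsOpen (U : Set G) ∧ ∀ k ∈ U, π k v = v}
  zero_mem' := ⟨⊤, isOpen_univ, fun k _ => map_zero (π k)⟩
  add_mem' := by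
    rintro v w ⟨U, hU, hv⟩ ⟨U', hU', hw⟩
    refine ⟨U ⊓ U', hU.inter hU', fun k hk => ?_⟩
    rw [map_add, hv k hk.1, hw k hk.2]
  smul_mem' := by
    rintro c v ⟨U, hU, hv⟩
    exact ⟨U, hU, fun k hk => by rw [map_smul, hv k hk]⟩

/-- The space of the smooth dual (contragredient) of `(π, V)`: the smooth vectors of the full
dual representation, which is `⟨π.dual g v', v⟩ = ⟨v', π g⁻¹ v⟩`. -/
def smoothDual {V : Type*} [AddCommGroup V] [Module ℂ V] (π : Representation ℂ G V) :
    Submodule ℂ (Module.Dual ℂ V) :=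
  smoothVectors π.dual

/-- The space of the smoothly induced representation `Ind_H^G σ`: functions `f : G → W` with
`f (h g) = σ h (f g)` for `h ∈ H`, that are right invariant under some open subgroup. -/
def SmoothInd (H : Subgroup G) {W : Type*} [AddCommGroup W] [Module ℂ W]
    (σ : Representation ℂ H W) : Submodule ℂ (G → W) where
  carrier := {f | (∀ (h : H) (g : G), f (h * g) = σ h (f g)) ∧
    ∃ U : Subgroup G, IsOpen (U : Set G) ∧ ∀ g, ∀ k ∈ U, f (g * k) = f g}
  zero_mem' := ⟨fun h _ => (map_zero (σ h)).symm, ⊤, isOpen_univ, fun _ _ _ => rfl⟩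
  add_mem' := by
    rintro f f' ⟨hf, U, hU, hfU⟩ ⟨hf', U', hU', hfU'⟩
    refine ⟨fun h g => ?_, U ⊓ U', hU.inter hU', fun g k hk => ?_⟩
    · simp only [Pi.add_apply, hf, hf', map_add]
    · simp only [Pi.add_apply, hfU g k hk.1, hfU' g k hk.2]
  smul_mem' := by
    rintro c f ⟨hf, U, hU, hfU⟩
    refine ⟨fun h g => ?_, U, hU, fun g k hk => ?_⟩
    · simp only [Pi.smul_apply, hf, map_smul]
    · simp only [Pi.smul_apply, hfU g k hk]

/-- The action of `G` on `Ind_H^G σ` by right translation, `(g • f) x = f (x g)`. -/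
def smoothInd (H : Subgroup G) {W : Type*} [AddCommGroup W] [Module ℂ W]
    (σ : Representation ℂ H W) : Representation ℂ G (SmoothInd H σ) where
  toFun g :=
    { toFun := fun f => ⟨fun x => f.1 (x * g), by
        obtain ⟨f, hf, U, hU, hfU⟩ := f
        refine ⟨fun h x => by simp only [mul_assoc, hf],
          U.comap (MulAut.conj g⁻¹).toMonoidHom, ?_, fun x k hk => ?_⟩
        · have hc : Continuous fun x : G => g⁻¹ * x * g⁻¹⁻¹ := by fun_prop
          exact hU.preimage hc
        · have hk' : g⁻¹ * k * g ∈ U := by simpa using hk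
          have h := hfU (x * g) _ hk'
          simpa [mul_assoc] using h⟩
      map_add' := fun _ _ => rfl
      map_smul' := fun _ _ => rfl }
  map_one' := by
    ext f x
    exact congrArg f.1 (mul_one x)
  map_mul' g g' := by
    ext f x
    exact congrArg f.1 (mul_assoc x g g').symm

/-- All functions `|⟨v', π(g) v⟩|²` (`v'` in the smooth dual) are functions on `G/Z`, `Z` the
centre of `G`, and are integrable there. -/
def IsSquareIntegrableModCenter {V : Type*} [AddCommGroup V] [Module ℂ V]
    (π : Representation ℂ G V) [MeasurableSpace (G ⧸ Subgroup.center G)]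
    (μ : Measure (G ⧸ Subgroup.center G)) : Prop :=
  ∀ v' ∈ smoothDual π, ∀ v : V, ∃ φ : G ⧸ Subgroup.center G → ℝ,
    (∀ g : G, φ (QuotientGroup.mk g) = ‖v' (π g v)‖ ^ 2) ∧ Integrable φ μ

/-- `d` is the formal dimension of the representation `π` of `G`, square-integrable modulo the
centre `Z`, with respect to the measure `μ` on `G/Z`: for all `v, w` in `V` and `v', w'` in the
smooth dual,
`∫_{G/Z} ⟨π.dual(g) v', v⟩ ⟨w', π(g) w⟩ dμ(g) = d⁻¹ ⟨v', w⟩ ⟨w', v⟩`.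
The integrand is a function `Φ` on `G/Z`, determined by its values at the classes of `g : G`. -/
structure IsFormalDimension {V : Type*} [AddCommGroup V] [Module ℂ V]
    (π : Representation ℂ G V) [MeasurableSpace (G ⧸ Subgroup.center G)]
    (μ : Measure (G ⧸ Subgroup.center G)) (d : ℝ) : Prop where
  pos : 0 < d
  squareIntegrable : IsSquareIntegrableModCenter π μ
  schur : ∀ v' ∈ smoothDual π, ∀ w' ∈ smoothDual π, ∀ v w : V,
    ∃ Φ : G ⧸ Subgroup.center G → ℂ,
      (∀ g : G, Φ (QuotientGroup.mk g) = π.dual g v' v * w' (π g w)) ∧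
      Integrable Φ μ ∧
      ∫ x, Φ x ∂μ = (d : ℂ)⁻¹ * (v' w * w' v)

end SmoothRepresentations

section GL2

variable (F : Type*) [Field F]

/-- The group `G = GL(2, F)`. -/
abbrev GL2 : Type _ := Matrix.GeneralLinearGroup (Fin 2) F

/-- The group `G/Z`, where `Z` is the centre of `G = GL(2, F)`. -/
abbrev GL2ModCenter : Type _ := GL2 F ⧸ Subgroup.center (GL2 F)

/-- The subgroup `B` of upper triangular matrices. -/
def borelSubgroup : Subgroup (GL2 F) where
  carrier := {g | g.1 1 0 = 0}
  one_mem' := by simp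
  mul_mem' := by
    intro g h hg hh
    simp only [Set.mem_ofPred_eq] at hg hh ⊢
    simp [Matrix.mul_apply, Fin.sum_univ_two, hg, hh]
  inv_mem' := by
    intro g hg
    simp only [Set.mem_ofPred_eq] at hg ⊢
    simp [Matrix.inv_def, Matrix.adjugate_fin_two, hg]

section Steinberg

variable [TopologicalSpace F] [IsTopologicalDivisionRing F]

/-- The line of constant functions in `Ind_B^G 1`. -/
def constantFunctions : Submodule ℂ
    (SmoothInd (borelSubgroup F) (Representation.trivial ℂ (borelSubgroup F) ℂ)) where
  carrier := {f | ∃ c : ℂ, ∀ g, f.1 g = c}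
  zero_mem' := ⟨0, fun _ => rfl⟩
  add_mem' := by
    rintro f f' ⟨c, hc⟩ ⟨c', hc'⟩
    exact ⟨c + c', fun g => congrArg₂ (· + ·) (hc g) (hc' g)⟩
  smul_mem' := by
    rintro a f ⟨c, hc⟩
    exact ⟨a * c, fun g => congrArg (a * ·) (hc g)⟩

/-- The Steinberg representation of `GL(2, F)`: the quotient of `Ind_B^G 1` by the constants. -/
def steinberg : Representation ℂ (GL2 F)
    (SmoothInd (borelSubgroup F) (Representation.trivial ℂ (borelSubgroup F) ℂ) ⧸
      constantFunctions F) :=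
  (smoothInd (borelSubgroup F) (Representation.trivial ℂ (borelSubgroup F) ℂ)).quotient
      (constantFunctions F) <| by
    rintro g f ⟨c, hc⟩
    exact ⟨c, fun x => hc (x * g)⟩

end Steinberg

section Compact

variable [ValuativeRel F]

/-- The maximal compact subgroup `K = GL(2, 𝒪)`: entries in `𝒪` and determinant in `𝒪ˣ`. -/
def maximalCompact : Set (GL2 F) :=
  {g | (∀ i j, valuation F (g.1 i j) ≤ 1) ∧ valuation F g.1.det = 1}

/-- The Iwahori subgroup `I`: diagonal entries in `𝒪ˣ`, upper right entry in `𝒪`, lower left entry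
in the maximal ideal `𝔭`. -/
def iwahori : Set (GL2 F) :=
  {g | valuation F (g.1 0 0) = 1 ∧ valuation F (g.1 1 1) = 1 ∧
    valuation F (g.1 0 1) ≤ 1 ∧ valuation F (g.1 1 0) < 1}

/-- The image `S.Z/Z` in `G/Z` of a subset `S` of `G = GL(2, F)`. -/
def imageModCenter {F : Type*} [Field F] (S : Set (GL2 F)) : Set (GL2ModCenter F) :=
  (QuotientGroup.mk : GL2 F → GL2ModCenter F) '' S

end Compact

end GL2

end

/-! Write φ for the class in the Steinberg space of the indicator of the disc |d| ≤ |c| in the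
projective line B\G, a point being given by its bottom row (c, d). Three facts about φ decide
everything. It is fixed by the Iwahori subgroup I. The element ω = (0, 1; ϖ, 0), which normalizes I,
carries the disc to its complement, so ω acts on φ by -1 modulo constants. The disc is the disjoint
union of q^n small discs, its translates by (ϖ^n, x; 0, 1) with x in 𝒪/𝔭^n, so φ is the sum of the
corresponding translates of itself (`sum_steinberg_discVec`).

If ℓ is an I-fixed functional, these facts force its coefficient at φ to be ±q^(-n) ℓ(φ) on the
coset of (ϖ^n, x; 0, 1), even after multiplication by ω on either side. Such cosets exhaust G/IZ
(`exists_cosetRep`, `cosetRep_injective`). In the language of the tree they are the oriented edges,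
n being the distance to a base edge. Since the translates of φ span V (`span_steinberg_discVec`),
I-fixed functionals form at most a line. Integrating over I the difference of the values at ωk and
at k gives one with ℓ(φ) = 1 (`discFunctional`).

Schur orthogonality then needs no irreducibility theorem. By averaging over I, every invariant
pairing of the smooth dual with V is a multiple of the canonical one (`pairing_eq`). The integral is
such a pairing in two ways, interchanged by inversion on the unimodular group G/Z. The remaining
constant is the squared L² norm of the coefficient of ℓ at φ. There are q^n cosets carrying the
value ±q^(-n), for each choice of the factors ω and each n admissible for it, so the norm is
vol(IZ/Z) · 2(1 + 1/q)/(1 - 1/q) = vol(IZ/Z) · 2(q + 1)/(q - 1), and d is its inverse. Part (ii)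
follows because K is a union of q + 1 cosets of I (`measure_maximalCompact`). -/

set_option linter.unusedSectionVars false

noncomputable section

namespace GL2Steinberg

/-! ### Discrete valuation, residue classes and topology of F. -/

section LocalField

variable (F : Type*) [Field F] [ValuativeRel F] [TopologicalSpace F]
    [IsNonarchimedeanLocalField F]

/-- The order of the residue field. -/
def resCard : ℕ := Nat.card 𝓀[F]

lemma one_lt_resCard : 1 < resCard F := Finite.one_lt_card

/-- A uniformizer, as an element of the ring of integers. -/
def unifInt : 𝒪[F] := (IsDiscreteValuationRing.exists_irreducible 𝒪[F]).choose

lemma irreducible_unifInt : Irreducible (unifInt F) :=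
  (IsDiscreteValuationRing.exists_irreducible 𝒪[F]).choose_spec

/-- A uniformizer of `F`. -/
def unif : F := unifInt F

lemma unif_ne_zero : unif F ≠ 0 := by
  have := (irreducible_unifInt F).ne_zero
  simpa [unif] using this

omit [TopologicalSpace F] [IsNonarchimedeanLocalField F] in
lemma integers_integer : (valuation F).Integers 𝒪[F] :=
  Valuation.integer.integers (valuation F)

variable {F}

omit [TopologicalSpace F] [IsNonarchimedeanLocalField F] in
lemma valuation_unit (x : 𝒪[F]) : IsUnit x ↔ valuation F (x : F) = 1 :=
  (integers_integer F).isUnit_iff_valuation_eq_one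

lemma valuation_unif_lt_one : valuation F (unif F) < 1 := by
  have h : ¬ IsUnit (unifInt F) := (irreducible_unifInt F).not_isUnit
  rw [valuation_unit] at h
  exact lt_of_le_of_ne (unifInt F).2 h

lemma valuation_unif_pos : 0 < valuation F (unif F) := by
  simpa [zero_lt_iff] using unif_ne_zero F

lemma mem_maximalIdeal_pow_iff (m : ℕ) (x : 𝒪[F]) :
    x ∈ 𝓂[F] ^ m ↔ valuation F (x : F) ≤ valuation F (unif F) ^ m := by
  rw [(irreducible_unifInt F).maximalIdeal_eq, Ideal.span_singleton_pow,
    Ideal.mem_span_singleton, (integers_integer F).dvd_iff_le]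
  change valuation F (x : F) ≤ valuation F ((unifInt F ^ m : 𝒪[F]) : F) ↔ _
  rw [SubmonoidClass.coe_pow, map_pow]; rfl

/-- The valuation is discrete, with no value strictly between |ϖ| and 1. This turns strict into weak
inequalities when ω exchanges the off-diagonal conditions defining I, and a disc with its
complement. -/
lemma valuation_le_unif_iff (x : F) :
    valuation F x ≤ valuation F (unif F) ↔ valuation F x < 1 := by
  refine ⟨fun h => h.trans_lt valuation_unif_lt_one, fun h => ?_⟩
  have h1 := mem_maximalIdeal_pow_iff 1 (⟨x, h.le⟩ : 𝒪[F])
  rw [pow_one, pow_one, IsLocalRing.mem_maximalIdeal, mem_nonunits_iff, valuation_unit] at h1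
  exact h1.1 h.ne

lemma valuation_eq_pow_of_le_one {x : F} (hx : x ≠ 0) (h : valuation F x ≤ 1) :
    ∃ n : ℕ, valuation F x = valuation F (unif F) ^ n := by
  have hx' : (⟨x, h⟩ : 𝒪[F]) ≠ 0 := by simpa [Subtype.ext_iff] using hx
  obtain ⟨n, u, hu⟩ := IsDiscreteValuationRing.associated_pow_irreducible hx' (irreducible_unifInt F)
  refine ⟨n, ?_⟩
  have hu1 : valuation F ((u : 𝒪[F]) : F) = 1 := (valuation_unit _).1 u.isUnit
  have := congrArg (fun y : 𝒪[F] => valuation F (y : F)) hu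
  simp only [Subring.coe_mul, SubmonoidClass.coe_pow, map_mul, map_pow, hu1, mul_one] at this
  exact this

lemma valuation_eq_zpow {x : F} (hx : x ≠ 0) :
    ∃ n : ℤ, valuation F x = valuation F (unif F) ^ n := by
  rcases le_total (valuation F x) 1 with h | h
  · obtain ⟨n, hn⟩ := valuation_eq_pow_of_le_one hx h
    exact ⟨n, by simpa using hn⟩
  · have h' : valuation F x⁻¹ ≤ 1 := by
      rw [map_inv₀]; exact inv_le_one_of_one_le₀ h
    obtain ⟨n, hn⟩ := valuation_eq_pow_of_le_one (inv_ne_zero hx) h'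
    refine ⟨-n, ?_⟩
    rw [map_inv₀] at hn
    rw [zpow_neg, zpow_natCast, ← hn, inv_inv]

lemma zpow_unif_le_iff {m n : ℤ} :
    valuation F (unif F) ^ m ≤ valuation F (unif F) ^ n ↔ n ≤ m :=
  zpow_le_zpow_iff_right_of_lt_one₀ valuation_unif_pos valuation_unif_lt_one

lemma zpow_unif_lt_iff {m n : ℤ} :
    valuation F (unif F) ^ m < valuation F (unif F) ^ n ↔ n < m :=
  zpow_lt_zpow_iff_right_of_lt_one₀ valuation_unif_pos valuation_unif_lt_one

lemma card_quotient_maximalIdeal_pow (m : ℕ) : Nat.card (𝒪[F] ⧸ 𝓂[F] ^ m) = resCard F ^ m := by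
  have h : 𝓂[F] ≠ ⊥ := IsDiscreteValuationRing.not_a_field 𝒪[F]
  exact cardQuot_pow_of_prime (P := 𝓂[F]) h

instance finite_quotient_maximalIdeal_pow (m : ℕ) : Finite (𝒪[F] ⧸ 𝓂[F] ^ m) := by
  apply Nat.finite_of_card_ne_zero
  rw [card_quotient_maximalIdeal_pow]
  exact pow_ne_zero _ (one_lt_resCard F).ne_bot

variable (F) in
/-- Representatives of `𝒪 / 𝔭 ^ m`. -/
def reps (m : ℕ) : Finset F :=
  (Set.finite_range fun c : 𝒪[F] ⧸ 𝓂[F] ^ m => ((Quotient.out c : 𝒪[F]) : F)).toFinset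

lemma card_reps (m : ℕ) : (reps F m).card = resCard F ^ m := by
  rw [← card_quotient_maximalIdeal_pow, reps, ← Set.ncard_eq_toFinset_card _ (Set.finite_range _), ← Set.image_univ,
    Set.ncard_image_of_injective, Set.ncard_univ]
  exact Subtype.val_injective.comp Quotient.out_injective

lemma valuation_le_one_of_mem_reps {m : ℕ} {x : F} (hx : x ∈ reps F m) : valuation F x ≤ 1 := by
  simp only [reps, Set.Finite.mem_toFinset, Set.mem_range] at hx
  obtain ⟨c, rfl⟩ := hx
  exact (Quotient.out c).2

lemma existsUnique_mem_reps (m : ℕ) {y : F} (hy : valuation F y ≤ 1) :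
    ∃! x, x ∈ reps F m ∧ valuation F (y - x) ≤ valuation F (unif F) ^ m := by
  have key (c : 𝒪[F] ⧸ 𝓂[F] ^ m) :
      valuation F (y - (Quotient.out c : 𝒪[F])) ≤ valuation F (unif F) ^ m ↔
        Ideal.Quotient.mk (𝓂[F] ^ m) ⟨y, hy⟩ = c := by
    conv_rhs => rw [← Quotient.out_eq c]
    refine Iff.trans ?_ (Ideal.Quotient.mk_eq_mk_iff_sub_mem _ _).symm
    rw [mem_maximalIdeal_pow_iff]; rfl
  refine ⟨_, ⟨?_, (key _).2 rfl⟩, ?_⟩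
  · simp [reps]
  · rintro x ⟨hx, h⟩
    simp only [reps, Set.Finite.mem_toFinset, Set.mem_range] at hx
    obtain ⟨c, rfl⟩ := hx
    rw [(key _).1 h]

lemma eq_of_mem_reps {m : ℕ} {x y : F} (hx : x ∈ reps F m) (hy : y ∈ reps F m)
    (h : valuation F (x - y) ≤ valuation F (unif F) ^ m) : x = y := by
  refine (existsUnique_mem_reps m (valuation_le_one_of_mem_reps hx)).unique ⟨hx, ?_⟩ ⟨hy, h⟩
  simp

lemma hasBasis_nhds_zero :
    (nhds (0 : F)).HasBasis (fun _ : ℕ => True)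
      fun n => {x | valuation F x ≤ valuation F (unif F) ^ n} := by
  refine (IsValuativeTopology.hasBasis_nhds_zero' F).to_hasBasis ?_ ?_
  · intro γ hγ
    obtain ⟨x, rfl⟩ := ValuativeRel.valuation_surjective γ
    obtain ⟨n, hn⟩ := valuation_eq_zpow (x := x) (by simpa using hγ)
    refine ⟨n.toNat + 1, trivial, fun y hy => ?_⟩
    change valuation F y < _
    refine (show valuation F y ≤ valuation F (unif F) ^ (n.toNat + 1) from hy).trans_lt ?_
    rw [hn, ← zpow_natCast, zpow_unif_lt_iff]
    lia
  · intro n _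
    exact ⟨valuation F (unif F) ^ n, pow_ne_zero _ valuation_unif_pos.ne', fun y hy => (show valuation F y < _ from hy).le⟩

lemma isOpen_valuation_le (n : ℕ) :
    IsOpen {x : F | valuation F x ≤ valuation F (unif F) ^ n} := by
  let S : AddSubgroup F :=
    { carrier := {x : F | valuation F x ≤ valuation F (unif F) ^ n}
      zero_mem' := by simp
      add_mem' := fun {x y} hx hy => by
        simp only [Set.mem_ofPred_eq] at hx hy ⊢
        exact (valuation F).map_add_le hx hy
      neg_mem' := fun {x} hx => by simpa using hx }
  exact S.isOpen_of_mem_nhds (g := 0) (hasBasis_nhds_zero.mem_of_mem trivial)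

instance : FirstCountableTopology F where
  nhds_generated_countable a := by
    have h0 : (nhds (0 : F)).IsCountablyGenerated := hasBasis_nhds_zero.isCountablyGenerated
    rw [← map_add_left_nhds_zero a]
    infer_instance

instance : SigmaCompactSpace F := by
  refine SigmaCompactSpace.of_countable
    (Set.range fun n : ℕ => {x : F | valuation F x ≤ valuation F (unif F) ^ (-(n : ℤ))})
    (Set.countable_range _) ?_ ?_
  · rintro _ ⟨n, rfl⟩
    exact IsNonarchimedeanLocalField.isCompact_closedBall F _
  · refine Set.eq_univ_of_forall fun x => ?_
    rcases eq_or_ne x 0 with rfl | hx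
    · exact ⟨_, ⟨0, rfl⟩, by simp⟩
    · obtain ⟨n, hn⟩ := valuation_eq_zpow hx
      refine ⟨_, ⟨n.natAbs, rfl⟩, ?_⟩
      change valuation F x ≤ _
      rw [hn, zpow_unif_le_iff]
      lia

instance : T2Space F := by
  let := IsTopologicalAddGroup.rightUniformSpace F
  have := isUniformAddGroup_of_addCommGroup (G := F)
  infer_instance

/-- F is pseudometrizable, its uniformity being countably generated, and a σ-compact pseudometric
space is second countable. The property passes to G and G/Z, where it serves the uniqueness of Haar
measure. -/
instance : SecondCountableTopology F := by
  let := IsTopologicalAddGroup.rightUniformSpace F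
  have := isUniformAddGroup_of_addCommGroup (G := F)
  have : (uniformity F).IsCountablyGenerated := IsUniformAddGroup.uniformity_countably_generated
  let := UniformSpace.pseudoMetricSpace F
  infer_instance

instance : SecondCountableTopology (GL2 F) := by
  have : SecondCountableTopology (Matrix (Fin 2) (Fin 2) F) :=
    inferInstanceAs (SecondCountableTopology (Fin 2 → Fin 2 → F))
  have : SecondCountableTopology (Matrix (Fin 2) (Fin 2) F)ᵐᵒᵖ :=
    MulOpposite.opHomeomorph.symm.isEmbedding.secondCountableTopology
  exact (Units.isEmbedding_embedProduct (M := Matrix (Fin 2) (Fin 2) F)).secondCountableTopology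

instance : LocallyCompactSpace (GL2 F) := by
  have : LocallyCompactSpace (Matrix (Fin 2) (Fin 2) F) :=
    inferInstanceAs (LocallyCompactSpace (Fin 2 → Fin 2 → F))
  have : T2Space (Matrix (Fin 2) (Fin 2) F) :=
    inferInstanceAs (T2Space (Fin 2 → Fin 2 → F))
  infer_instance

end LocalField

/-! ### Matrices by entries, and the Iwahori subgroup modulo the centre. -/

section Cosets

variable (F : Type*) [Field F] [ValuativeRel F]

lemma center_eq_scalar {F : Type*} [Field F] {z : GL2 F} (hz : z ∈ Subgroup.center (GL2 F)) :
    ∃ c : F, c ≠ 0 ∧ z.1 = !![c, 0; 0, c] := by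
  obtain ⟨a, ha⟩ := Matrix.GeneralLinearGroup.mem_center_iff_val_mem_range_scalar.1 hz
  have h : z.1 = !![a, 0; 0, a] := by
    rw [← ha]; ext i j; fin_cases i <;> fin_cases j <;> simp
  refine ⟨a, ?_, h⟩
  rintro rfl
  have := z.isUnit.map Matrix.detMonoidHom
  simp [h] at this

lemma mem_center_of_eq_scalar {F : Type*} [Field F] {z : GL2 F} {c : F}
    (hz : z.1 = !![c, 0; 0, c]) : z ∈ Subgroup.center (GL2 F) := by
  refine Matrix.GeneralLinearGroup.mem_center_iff_val_mem_range_scalar.2 ⟨c, ?_⟩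
  rw [hz]; ext i j; fin_cases i <;> fin_cases j <;> simp

/-- An element of `GL(2, F)` given by its entries. -/
def mat {F : Type*} [Field F] (a b c d : F) (h : a * d - b * c ≠ 0) : GL2 F :=
  Matrix.GeneralLinearGroup.mkOfDetNeZero !![a, b; c, d] (by rwa [Matrix.det_fin_two_of])

@[simp] lemma val_mat {F : Type*} [Field F] (a b c d : F) (h : a * d - b * c ≠ 0) :
    (mat a b c d h).1 = !![a, b; c, d] := rfl

lemma det_entries_ne_zero {F : Type*} [Field F] (g : GL2 F) :
    g.1 0 0 * g.1 1 1 - g.1 0 1 * g.1 1 0 ≠ 0 := by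
  rw [← Matrix.det_fin_two]
  exact (g.isUnit.map Matrix.detMonoidHom).ne_zero

lemma eq_mat {F : Type*} [Field F] (g : GL2 F) :
    g = mat (g.1 0 0) (g.1 0 1) (g.1 1 0) (g.1 1 1) (det_entries_ne_zero g) := by
  apply Units.ext
  ext i j; fin_cases i <;> fin_cases j <;> rfl

lemma mat_mul_mat {F : Type*} [Field F] (a b c d h a' b' c' d' h') :
    mat (F := F) a b c d h * mat a' b' c' d' h' =
      mat (a * a' + b * c') (a * b' + b * d') (c * a' + d * c') (c * b' + d * d')
        (by convert mul_ne_zero h h' using 1; ring) := by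
  apply Units.ext
  simp only [Units.val_mul, val_mat]
  ext i j; fin_cases i <;> fin_cases j <;> simp [Matrix.mul_apply, Fin.sum_univ_two]

lemma mat_inv {F : Type*} [Field F] (a b c d h) :
    (mat (F := F) a b c d h)⁻¹ =
      mat (d / (a * d - b * c)) (-b / (a * d - b * c)) (-c / (a * d - b * c)) (a / (a * d - b * c))
        (by
          rw [show d / (a * d - b * c) * (a / (a * d - b * c)) -
            -b / (a * d - b * c) * (-c / (a * d - b * c)) = (a * d - b * c)⁻¹ by field_simp]
          exact inv_ne_zero h) := by
  rw [inv_eq_iff_mul_eq_one, mat_mul_mat]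
  apply Units.ext
  simp only [val_mat, Units.val_one]
  have h' : -(c * b) + a * d ≠ 0 := by convert h using 1; ring
  ext i j; fin_cases i <;> fin_cases j <;> simp <;> field_simp <;> ring_nf
  field_simp

/-- The Iwahori subgroup. -/
def iwahoriSubgroup : Subgroup (GL2 F) where
  carrier := iwahori F
  one_mem' := by simp [iwahori]
  mul_mem' := by
    rintro g h ⟨g1, g2, g3, g4⟩ ⟨h1, h2, h3, h4⟩
    simp only [iwahori, Set.mem_ofPred_eq, Units.val_mul, Matrix.mul_apply, Fin.sum_univ_two]
    have e1 : valuation F (g.1 0 1 * h.1 1 0) < 1 := by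
      rw [map_mul]; exact (mul_le_of_le_one_left' g3).trans_lt h4
    have e2 : valuation F (g.1 1 0 * h.1 0 1) < 1 := by
      rw [map_mul]; exact (mul_le_of_le_one_right' h3).trans_lt g4
    refine ⟨?_, ?_, ?_, ?_⟩
    · rw [Valuation.map_add_eq_of_lt_left] <;> simp_all
    · rw [Valuation.map_add_eq_of_lt_right] <;> simp_all
    · refine (valuation F).map_add_le ?_ ?_ <;> simp_all
    · refine (valuation F).map_add_lt ?_ ?_ <;> simp_all
  inv_mem' := by
    rintro g ⟨g1, g2, g3, g4⟩
    have hdet : valuation F (g.1 0 0 * g.1 1 1 - g.1 0 1 * g.1 1 0) = 1 := by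
      rw [Valuation.map_sub_eq_of_lt_left, map_mul, g1, g2, one_mul]
      rw [map_mul, map_mul, g1, g2, one_mul]
      exact (mul_le_of_le_one_left' g3).trans_lt g4
    rw [eq_mat g, mat_inv]
    simp [iwahori, map_div₀, hdet, g1, g2, g3, g4]

/-- The image of the Iwahori subgroup in `G/Z`. -/
def iwahoriBar : Subgroup (GL2ModCenter F) :=
  (iwahoriSubgroup F).map (QuotientGroup.mk' (Subgroup.center (GL2 F)))

lemma coe_iwahoriBar : (iwahoriBar F : Set (GL2ModCenter F)) = imageModCenter (iwahori F) := rfl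

variable {F}

/-- The conditions are homogeneous in the entries, so they do not see the centre. The strict
inequality forces the upper left entry to be nonzero, and dividing by it lands in I. -/
lemma mk_mem_iwahoriBar_iff (g : GL2 F) :
    (QuotientGroup.mk g : GL2ModCenter F) ∈ iwahoriBar F ↔
      valuation F (g.1 0 0) = valuation F (g.1 1 1) ∧
      valuation F (g.1 0 1) ≤ valuation F (g.1 0 0) ∧
      valuation F (g.1 1 0) < valuation F (g.1 0 0) := by
  constructor
  · rintro ⟨i, ⟨i1, i2, i3, i4⟩, hi⟩
    obtain ⟨c, hc, hz⟩ := center_eq_scalar (QuotientGroup.eq.1 hi)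
    have hg : g = i * (i⁻¹ * g) := by group
    have hc' : 0 < valuation F c := by simpa [zero_lt_iff] using hc
    have := congrArg Units.val hg
    rw [Units.val_mul, hz] at this
    rw [this]
    simp only [Matrix.mul_apply, Fin.sum_univ_two]
    simp only [Matrix.of_apply, Matrix.cons_val', Matrix.cons_val_zero, Matrix.cons_val_one,
      Matrix.cons_val_fin_one, mul_zero, add_zero, zero_add, map_mul, i1, i2, one_mul, true_and]
    exact ⟨mul_le_of_le_one_left' i3, by
      simpa using mul_lt_mul_of_pos_right i4 hc'⟩
  · rintro ⟨h1, h2, h3⟩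
    have h0 : 0 < valuation F (g.1 0 0) := lt_of_le_of_lt zero_le h3
    have h0' : g.1 0 0 ≠ 0 := by simpa [zero_lt_iff] using h0
    let z : GL2 F := mat (g.1 0 0) 0 0 (g.1 0 0) (by simpa using h0')
    have hz : z⁻¹ ∈ Subgroup.center (GL2 F) := inv_mem (mem_center_of_eq_scalar (val_mat _ _ _ _ _))
    refine ⟨g * z⁻¹, ?_, ?_⟩
    · change _ ∈ iwahori F
      have e : (g * z⁻¹).1 = !![1, g.1 0 1 / g.1 0 0; g.1 1 0 / g.1 0 0, g.1 1 1 / g.1 0 0] := by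
        rw [mat_inv, Units.val_mul, val_mat]
        ext i j; fin_cases i <;> fin_cases j <;>
          simp [Matrix.mul_apply, Fin.sum_univ_two] <;> field_simp
      simp only [iwahori, Set.mem_ofPred_eq, e]
      simp only [Matrix.of_apply, Matrix.cons_val', Matrix.cons_val_zero, Matrix.cons_val_one,
        Matrix.cons_val_fin_one, map_one, map_div₀, true_and]
      refine ⟨by rw [h1, div_self (h1 ▸ h0.ne')], div_le_one_of_le₀ h2 (zero_le), ?_⟩
      rwa [div_lt_one₀ h0]
    · exact QuotientGroup.mk_mul_of_mem _ hz

lemma mk_inv_mul_mk_mem_iwahoriBar_iff (g h : GL2 F) :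
    (QuotientGroup.mk g : GL2ModCenter F)⁻¹ * QuotientGroup.mk h ∈ iwahoriBar F ↔
      valuation F (g.1 1 1 * h.1 0 0 - g.1 0 1 * h.1 1 0) =
        valuation F (g.1 0 0 * h.1 1 1 - g.1 1 0 * h.1 0 1) ∧
      valuation F (g.1 1 1 * h.1 0 1 - g.1 0 1 * h.1 1 1) ≤
        valuation F (g.1 1 1 * h.1 0 0 - g.1 0 1 * h.1 1 0) ∧
      valuation F (g.1 0 0 * h.1 1 0 - g.1 1 0 * h.1 0 0) <
        valuation F (g.1 1 1 * h.1 0 0 - g.1 0 1 * h.1 1 0) := by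
  rw [← QuotientGroup.mk_inv, ← QuotientGroup.mk_mul, mk_mem_iwahoriBar_iff]
  set D := g.1 0 0 * g.1 1 1 - g.1 0 1 * g.1 1 0 with hD
  have hD0 : D ≠ 0 := det_entries_ne_zero g
  have hD1 : 0 < valuation F D := by simpa [zero_lt_iff] using hD0
  have e : (g⁻¹ * h).1 = !![(g.1 1 1 * h.1 0 0 - g.1 0 1 * h.1 1 0) / D,
      (g.1 1 1 * h.1 0 1 - g.1 0 1 * h.1 1 1) / D;
      (g.1 0 0 * h.1 1 0 - g.1 1 0 * h.1 0 0) / D,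
      (g.1 0 0 * h.1 1 1 - g.1 1 0 * h.1 0 1) / D] := by
    conv_lhs => rw [eq_mat g, eq_mat h]
    rw [mat_inv, mat_mul_mat, val_mat, ← hD]
    ext i j; fin_cases i <;> fin_cases j <;> simp <;> ring
  rw [e]
  simp only [Matrix.of_apply, Matrix.cons_val', Matrix.cons_val_zero, Matrix.cons_val_one,
    Matrix.cons_val_fin_one, map_div₀]
  rw [div_le_div_iff_of_pos_right hD1, div_lt_div_iff_of_pos_right hD1, div_left_inj' hD1.ne']

end Cosets

/-! ### Representatives of the cosets of the Iwahori subgroup in G/Z. -/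

section Reps

variable {F : Type*} [Field F] [ValuativeRel F] [TopologicalSpace F]
    [IsNonarchimedeanLocalField F]

/-- Upper unipotent matrices. -/
def uni {F : Type*} [Field F] (x : F) : GL2 F := mat 1 x 0 1 (by simp)

variable (F) in
/-- The diagonal matrix `diag(ϖ ^ n, 1)`. -/
def dia (n : ℕ) : GL2 F := mat (unif F ^ n) 0 0 1 (by simpa using pow_ne_zero _ (unif_ne_zero F))

variable (F) in
/-- The element `(0, 1; ϖ, 0)` normalizing the Iwahori subgroup. -/
def om : GL2 F := mat 0 1 (unif F) 0 (by simpa using unif_ne_zero F)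

lemma uni_mul_dia (x : F) (n : ℕ) :
    uni x * dia F n = mat (unif F ^ n) x 0 1 (by simpa using pow_ne_zero _ (unif_ne_zero F)) := by
  rw [uni, dia, mat_mul_mat]; congr 1 <;> simp

lemma om_mul_self : om F * om F = mat (unif F) 0 0 (unif F)
    (by simpa using unif_ne_zero F) := by
  rw [om, mat_mul_mat]; congr 1 <;> simp

variable (F) in
/-- The class of `om` in `G/Z`. -/
def omBar : GL2ModCenter F := QuotientGroup.mk (om F)

lemma omBar_mul_self : omBar F * omBar F = 1 := by
  rw [omBar, ← QuotientGroup.mk_mul, om_mul_self]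
  exact (QuotientGroup.eq_one_iff _).2 (mem_center_of_eq_scalar (val_mat _ _ _ _ _))

lemma omBar_inv : (omBar F)⁻¹ = omBar F := inv_eq_of_mul_eq_one_left omBar_mul_self

/-- Up to the scalar ϖ, conjugation by ω swaps a with d and sends (b, c) to (c/ϖ, ϖb). Discreteness
of the valuation makes |c| < |a| equivalent to |c/ϖ| ≤ |a|. -/
lemma omBar_conj_mem {q : GL2ModCenter F} (hq : q ∈ iwahoriBar F) :
    omBar F * q * omBar F ∈ iwahoriBar F := by
  obtain ⟨g, rfl⟩ := QuotientGroup.mk_surjective q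
  rw [mk_mem_iwahoriBar_iff] at hq
  obtain ⟨h1, h2, h3⟩ := hq
  rw [omBar, ← QuotientGroup.mk_mul, ← QuotientGroup.mk_mul, mk_mem_iwahoriBar_iff]
  have hp : 0 < valuation F (unif F) := valuation_unif_pos
  have e : (om F * g * om F).1 = !![g.1 1 1 * unif F, g.1 1 0; unif F * g.1 0 1 * unif F,
      unif F * g.1 0 0] := by
    conv_lhs => rw [eq_mat g]
    rw [om, mat_mul_mat, mat_mul_mat, val_mat]
    ext i j; fin_cases i <;> fin_cases j <;> simp
  rw [e]
  simp only [Matrix.of_apply, Matrix.cons_val', Matrix.cons_val_zero, Matrix.cons_val_one,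
      Matrix.cons_val_fin_one, map_mul]
  rw [← h1]
  have h0 : 0 < valuation F (g.1 0 0) := lt_of_le_of_lt zero_le h3
  refine ⟨mul_comm _ _, ?_, ?_⟩
  · have h4 : valuation F (g.1 1 0 / g.1 0 0) < 1 := by
      rwa [map_div₀, div_lt_one₀ h0]
    rw [← valuation_le_unif_iff, map_div₀, div_le_iff₀ h0] at h4
    rwa [mul_comm]
  · refine mul_lt_mul_of_pos_right ?_ hp
    calc valuation F (unif F) * valuation F (g.1 0 1)
        ≤ valuation F (unif F) * valuation F (g.1 0 0) := by gcongr
      _ < 1 * valuation F (g.1 0 0) := mul_lt_mul_of_pos_right valuation_unif_lt_one h0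
      _ = _ := one_mul _

lemma omBar_conj_mem_iff {q : GL2ModCenter F} :
    omBar F * q * omBar F ∈ iwahoriBar F ↔ q ∈ iwahoriBar F := by
  refine ⟨fun h => ?_, omBar_conj_mem⟩
  have := omBar_conj_mem h
  rwa [show omBar F * (omBar F * q * omBar F) * omBar F =
    (omBar F * omBar F) * q * (omBar F * omBar F) by group, omBar_mul_self, one_mul, mul_one] at this

/-- Classes of `uni x * dia n` in `G/Z`. -/
def pt (x : F) (n : ℕ) : GL2ModCenter F := QuotientGroup.mk (uni x * dia F n)

lemma pt_inv_mul_pt_mem_iff {x y : F} {m n : ℕ} :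
    (pt x m)⁻¹ * pt y n ∈ iwahoriBar F ↔
      m = n ∧ valuation F (x - y) ≤ valuation F (unif F) ^ m := by
  rw [pt, pt, mk_inv_mul_mk_mem_iwahoriBar_iff, uni_mul_dia, uni_mul_dia]
  simp only [val_mat, Matrix.of_apply, Matrix.cons_val', Matrix.cons_val_zero, Matrix.cons_val_one,
      Matrix.cons_val_fin_one, mul_zero, zero_mul, sub_zero, one_mul, map_pow, mul_one,
      map_zero]
  rw [Valuation.map_sub_swap]
  constructor
  · rintro ⟨h, h', -⟩
    have := (pow_right_strictAnti₀ (valuation_unif_pos (F := F)) valuation_unif_lt_one).injective h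
    subst this
    exact ⟨rfl, h'⟩
  · rintro ⟨rfl, h⟩; exact ⟨rfl, h, pow_pos valuation_unif_pos _⟩

lemma valuation_one_sub_unif_mul {x : F} (hx : valuation F x ≤ 1) :
    valuation F (1 - unif F * x) = 1 := by
  rw [Valuation.map_sub_eq_of_lt_left, map_one]
  rw [map_one, map_mul]
  exact (mul_le_of_le_one_right' hx).trans_lt valuation_unif_lt_one

/-- An upper triangular matrix times ω has lower right entry 0, which no element of IZ has. -/
lemma pt_inv_mul_pt_mul_omBar_notMem {x y : F} {m n : ℕ} :
    (pt x m)⁻¹ * (pt y n * omBar F) ∉ iwahoriBar F := by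
  rw [pt, pt, omBar, ← QuotientGroup.mk_mul, mk_inv_mul_mk_mem_iwahoriBar_iff, uni_mul_dia,
    uni_mul_dia, om, mat_mul_mat]
  simp only [val_mat, Matrix.of_apply, Matrix.cons_val', Matrix.cons_val_zero, Matrix.cons_val_one,
    Matrix.cons_val_fin_one]
  rintro ⟨h1, h2, h3⟩
  rw [h1] at h3
  simp at h3

/-- Up to a scalar, the upper right entry of the product is a unit while the upper left one lies in
𝔭. -/
lemma pt_inv_mul_omBar_mul_pt_notMem {x y : F} {m n : ℕ} (hx : valuation F x ≤ 1)
    (hy : valuation F y ≤ 1) : (pt x m)⁻¹ * (omBar F * pt y n) ∉ iwahoriBar F := by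
  rw [pt, pt, omBar, ← QuotientGroup.mk_mul, mk_inv_mul_mk_mem_iwahoriBar_iff, uni_mul_dia,
    uni_mul_dia, om, mat_mul_mat]
  simp only [val_mat, Matrix.of_apply, Matrix.cons_val', Matrix.cons_val_zero, Matrix.cons_val_one,
    Matrix.cons_val_fin_one]
  rintro ⟨-, h, -⟩
  rw [show 1 * (0 * y + 1 * 1) - x * (unif F * y + 0 * 1) = 1 - unif F * (x * y) by ring,
    valuation_one_sub_unif_mul (by rw [map_mul]; exact mul_le_one' hx hy)] at h
  refine h.not_gt ?_
  rw [show 1 * (0 * unif F ^ n + 1 * 0) - x * (unif F * unif F ^ n + 0 * 0) =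
    -(unif F ^ (n + 1) * x) by ring, Valuation.map_neg, map_mul, map_pow]
  exact (mul_le_of_le_one_right' hx).trans_lt
    (pow_lt_one₀ zero_le valuation_unif_lt_one n.succ_ne_zero)

/-- Up to a common scalar, the diagonal entries have valuations |ϖ| and |ϖ|^(m+n+1), which agree
only for m = n = 0. That coincidence is genuine, as ω·ω is central; it is why the exponent in
`CosetIdx` is raised by one when ω stands on the left. -/
lemma pt_inv_mul_omBar_mul_pt_mul_omBar_mem {x y : F} {m n : ℕ} (hx : valuation F x ≤ 1)
    (hy : valuation F y ≤ 1) (h : (pt x m)⁻¹ * (omBar F * pt y n * omBar F) ∈ iwahoriBar F) :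
    n = 0 := by
  rw [pt, pt, omBar, ← QuotientGroup.mk_mul, ← QuotientGroup.mk_mul,
    mk_inv_mul_mk_mem_iwahoriBar_iff, uni_mul_dia,
    uni_mul_dia, om, mat_mul_mat, mat_mul_mat] at h
  simp only [val_mat, Matrix.of_apply, Matrix.cons_val', Matrix.cons_val_zero, Matrix.cons_val_one,
    Matrix.cons_val_fin_one] at h
  replace h := h.1
  ring_nf at h
  rw [show unif F - unif F ^ 2 * y * x = unif F * (1 - unif F * (x * y)) by ring, map_mul,
    valuation_one_sub_unif_mul (by rw [map_mul]; exact mul_le_one' hx hy), mul_one,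
    ← pow_succ', ← pow_add, map_pow] at h
  have := (pow_right_strictAnti₀ (valuation_unif_pos (F := F)) valuation_unif_lt_one).injective
    ((pow_one (valuation F (unif F))).trans h)
  lia

/-- For (t, y; 0, 1) the three alternatives correspond to: t and y both integral; otherwise |y| ≤
|t|, so that t is not integral; otherwise |y| > |t|, so that y is not integral. -/
lemma exists_pt_of_upper (g : GL2 F) (hc : g.1 1 0 = 0) (hd : g.1 1 1 = 1) :
    (∃ m, ∃ x ∈ reps F m, (pt x m)⁻¹ * QuotientGroup.mk g ∈ iwahoriBar F) ∨
    (∃ m, ∃ x ∈ reps F (m + 1),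
      (omBar F * pt x (m + 1))⁻¹ * QuotientGroup.mk g ∈ iwahoriBar F) ∨
    (∃ m, ∃ x ∈ reps F (m + 1),
      (omBar F * pt x (m + 1) * omBar F)⁻¹ * QuotientGroup.mk g ∈ iwahoriBar F) := by
  have hπ0 : 0 < valuation F (unif F) := valuation_unif_pos
  have ht0 : g.1 0 0 ≠ 0 := by
    have := det_entries_ne_zero g
    rw [hc, hd] at this; simpa using this
  set t := g.1 0 0 with ht
  set y := g.1 0 1 with hy
  obtain ⟨k, hk⟩ := valuation_eq_zpow ht0
  by_cases h1 : valuation F y ≤ 1 ∧ 0 ≤ k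
  · obtain ⟨h1, hk0⟩ := h1
    lift k to ℕ using hk0
    obtain ⟨x, ⟨hx, hxy⟩, -⟩ := existsUnique_mem_reps k h1
    refine Or.inl ⟨k, x, hx, ?_⟩
    rw [pt, mk_inv_mul_mk_mem_iwahoriBar_iff, uni_mul_dia, hc, hd]
    simp only [val_mat, Matrix.of_apply, Matrix.cons_val', Matrix.cons_val_zero, Matrix.cons_val_one,
    Matrix.cons_val_fin_one]
    simp only [← ht, ← hy, hk, one_mul, mul_zero, sub_zero, mul_one, map_pow, zero_mul, sub_self,
      map_zero, zpow_natCast, hxy, true_and]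
    exact pow_pos hπ0 _
  by_cases h2 : valuation F y ≤ valuation F t
  · have hk0 : k < 0 := by
      by_contra! hk0
      refine h1 ⟨h2.trans ?_, hk0⟩
      rw [hk]
      simpa using (zpow_unif_le_iff (F := F) (n := 0)).2 hk0
    obtain ⟨m, hm⟩ : ∃ m : ℕ, k = -((m + 1 : ℕ) : ℤ) := ⟨(-k - 1).toNat, by lia⟩
    -- Here x has to be the chosen representative of the class of 0, which need not be 0 itself.
    obtain ⟨x, ⟨hx, hxy⟩, -⟩ := existsUnique_mem_reps (F := F) (m + 1) (y := 0) (by simp)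
    refine Or.inr (Or.inr ⟨m, x, hx, ?_⟩)
    rw [pt, omBar, ← QuotientGroup.mk_mul, ← QuotientGroup.mk_mul,
      mk_inv_mul_mk_mem_iwahoriBar_iff, uni_mul_dia, om, mat_mul_mat, mat_mul_mat, hc, hd]
    simp only [val_mat, Matrix.of_apply, Matrix.cons_val', Matrix.cons_val_zero, Matrix.cons_val_one,
    Matrix.cons_val_fin_one]
    rw [← ht, ← hy]
    rw [zero_sub, Valuation.map_neg] at hxy
    have hpt : valuation F (unif F) ^ (m + 1) * valuation F t = 1 := by
      rw [hk, hm, zpow_neg, zpow_natCast]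
      exact mul_inv_cancel₀ (pow_ne_zero _ hπ0.ne')
    have hxt : valuation F (x * t) ≤ 1 := by
      rw [map_mul, ← hpt]; gcongr
    have hxy1 : valuation F (x * y) ≤ 1 := by
      refine le_trans ?_ hxt
      rw [map_mul, map_mul]; gcongr
    have e1 : valuation F (unif F - unif F * (unif F * (x * y))) = valuation F (unif F) := by
      rw [show unif F - unif F * (unif F * (x * y)) = unif F * (1 - unif F * (x * y)) by ring,
        map_mul, valuation_one_sub_unif_mul hxy1, mul_one]
    have e2 : valuation F (unif F ^ (m + 2) * t) = valuation F (unif F) := by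
      rw [pow_succ', mul_assoc, map_mul, map_mul, map_pow, hpt, mul_one]
    have e3 : valuation F (unif F ^ (m + 2) * y) ≤ valuation F (unif F) := by
      rw [← e2, map_mul, map_mul]; gcongr
    have e4 : valuation F (unif F * (unif F * (x * t))) < valuation F (unif F) := by
      rw [map_mul, map_mul]
      calc _ ≤ valuation F (unif F) * (valuation F (unif F) * 1) := by gcongr
        _ < valuation F (unif F) * 1 := by
          exact mul_lt_mul_of_pos_left (by rw [mul_one]; exact valuation_unif_lt_one) hπ0
        _ = _ := mul_one _
    refine ⟨?_, ?_, ?_⟩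
    · convert e2.trans e1.symm using 1 <;> (congr 1; ring)
    · refine (le_of_eq ?_).trans (e3.trans (e2.ge.trans (le_of_eq ?_))) <;> (congr 1; ring)
    · convert e4.trans_eq e2.symm using 1
      · rw [← Valuation.map_neg]; congr 1; ring
      · congr 1; ring
  · push Not at h2
    have hy0 : y ≠ 0 := by
      rintro h; rw [h, map_zero] at h2; exact not_lt_zero h2
    obtain ⟨j, hj⟩ := valuation_eq_zpow hy0
    have hjk : j < k := by rwa [hk, hj, zpow_unif_lt_iff] at h2
    have hj0 : j < 0 := by
      by_contra! hj0
      refine h1 ⟨?_, by lia⟩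
      rw [hj]
      simpa using (zpow_unif_le_iff (F := F) (n := 0)).2 hj0
    -- Taking x close to (ϖy)⁻¹ makes 1 - ϖxy small. The diagonal entries are then, up to sign and a
    -- common scalar, ϖxt and ϖ^(m+2)y; equality of their valuations, k - j and m + 2 + j, gives the
    -- exponent.
    obtain ⟨m, hm⟩ : ∃ m : ℕ, ((m + 1 : ℕ) : ℤ) = k - 1 - 2 * j := ⟨(k - 2 - 2 * j).toNat, by lia⟩
    have hz : valuation F (unif F * y)⁻¹ ≤ 1 := by
      rw [map_inv₀, map_mul, hj, ← zpow_one_add₀ hπ0.ne', ← zpow_neg]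
      simpa using (zpow_unif_le_iff (F := F) (n := 0) (m := -(1 + j))).2 (by lia)
    obtain ⟨x, ⟨hx, hxy⟩, -⟩ := existsUnique_mem_reps (m + 1) hz
    refine Or.inr (Or.inl ⟨m, x, hx, ?_⟩)
    rw [pt, omBar, ← QuotientGroup.mk_mul,
      mk_inv_mul_mk_mem_iwahoriBar_iff, uni_mul_dia, om, mat_mul_mat, hc, hd]
    simp only [val_mat, Matrix.of_apply, Matrix.cons_val', Matrix.cons_val_zero, Matrix.cons_val_one,
    Matrix.cons_val_fin_one]
    rw [← ht, ← hy]
    have hu0 := unif_ne_zero F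
    have e1 : valuation F (1 - unif F * x * y) ≤ valuation F (unif F) ^ (k - j) := by
      rw [show 1 - unif F * x * y = ((unif F * y)⁻¹ - x) * (unif F * y) by field_simp, map_mul,
        map_mul, hj]
      calc _ ≤ valuation F (unif F) ^ (m + 1) * (valuation F (unif F) * valuation F (unif F) ^ j) := by
            gcongr
        _ = _ := by
          rw [← zpow_natCast, hm, ← zpow_one_add₀ hπ0.ne', ← zpow_add₀ hπ0.ne']; congr 1; ring
    have e2 : valuation F (unif F * x * y) = 1 := by
      have : valuation F (1 - unif F * x * y) < 1 := e1.trans_lt (by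
        simpa using (zpow_unif_lt_iff (F := F) (n := 0) (m := k - j)).2 (by lia))
      rw [show unif F * x * y = 1 - (1 - unif F * x * y) by ring, Valuation.map_sub_eq_of_lt_left,
        map_one]
      rwa [map_one]
    have e3 : valuation F (unif F * x * t) = valuation F (unif F) ^ (k - j) := by
      rw [show unif F * x * t = (unif F * x * y) * (t / y) by field_simp, map_mul, e2, one_mul,
        map_div₀, hk, hj, zpow_sub₀ hπ0.ne']
    have e4 : valuation F (unif F ^ (m + 2) * y) = valuation F (unif F) ^ (k - j) := by
      rw [map_mul, map_pow, hj, ← zpow_natCast, ← zpow_add₀ hπ0.ne']; congr 1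
      push_cast at hm ⊢; lia
    have e5 : valuation F (unif F ^ (m + 2) * t) < valuation F (unif F) ^ (k - j) := by
      rw [← e4, map_mul, map_mul]
      exact mul_lt_mul_of_pos_left h2 (by rw [map_pow]; exact pow_pos hπ0 _)
    refine ⟨?_, ?_, ?_⟩
    · convert e3.trans e4.symm using 1
      · congr 1; ring
      · rw [← Valuation.map_neg]; congr 1; ring
    · convert e1.trans_eq e3.symm using 1
      · rw [← Valuation.map_neg]; congr 1; ring
      · congr 1; ring
    · convert e5.trans_eq e3.symm using 1
      · rw [← Valuation.map_neg]; congr 1; ring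
      · congr 1; ring

/-- As c/d lies in 𝔭, a lower unipotent element of I clears the lower left entry by right
multiplication. Scaling the lower right entry to 1 then leaves the upper triangular case. -/
lemma exists_pt_of_lt (g : GL2 F) (h : valuation F (g.1 1 0) < valuation F (g.1 1 1)) :
    (∃ m, ∃ x ∈ reps F m, (pt x m)⁻¹ * QuotientGroup.mk g ∈ iwahoriBar F) ∨
    (∃ m, ∃ x ∈ reps F (m + 1),
      (omBar F * pt x (m + 1))⁻¹ * QuotientGroup.mk g ∈ iwahoriBar F) ∨
    (∃ m, ∃ x ∈ reps F (m + 1),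
      (omBar F * pt x (m + 1) * omBar F)⁻¹ * QuotientGroup.mk g ∈ iwahoriBar F) := by
  have hd : 0 < valuation F (g.1 1 1) := lt_of_le_of_lt zero_le h
  have hd0 : g.1 1 1 ≠ 0 := by simpa [zero_lt_iff] using hd
  have hA := det_entries_ne_zero g
  set A := g.1 0 0 * g.1 1 1 - g.1 0 1 * g.1 1 0 with hAdef
  have hA0 : 0 < valuation F (A / (g.1 1 1) ^ 2) := by
    rw [zero_lt_iff, Valuation.ne_zero_iff]
    exact div_ne_zero hA (pow_ne_zero _ hd0)
  let g₀ : GL2 F := mat (A / (g.1 1 1) ^ 2) (g.1 0 1 / g.1 1 1) 0 1 (by simp [hA, hd0])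
  have hg : (QuotientGroup.mk g₀ : GL2ModCenter F)⁻¹ * QuotientGroup.mk g ∈ iwahoriBar F := by
    rw [mk_inv_mul_mk_mem_iwahoriBar_iff]
    have g00 : g₀.1 0 0 = A / (g.1 1 1) ^ 2 := rfl
    have g01 : g₀.1 0 1 = g.1 0 1 / g.1 1 1 := rfl
    have g10 : g₀.1 1 0 = 0 := rfl
    have g11 : g₀.1 1 1 = 1 := rfl
    rw [g00, g01, g10, g11]
    have e1 : 1 * g.1 0 0 - g.1 0 1 / g.1 1 1 * g.1 1 0 = A / (g.1 1 1) ^ 2 * g.1 1 1 := by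
      field_simp; rw [hAdef]
    have e2 : 1 * g.1 0 1 - g.1 0 1 / g.1 1 1 * g.1 1 1 = 0 := by field_simp; simp
    rw [e1, e2]
    simp only [zero_mul, sub_zero, map_zero, map_mul, zero_le, true_and]
    exact mul_lt_mul_of_pos_left h hA0
  have key (p : GL2ModCenter F) (hp : p⁻¹ * QuotientGroup.mk g₀ ∈ iwahoriBar F) :
      p⁻¹ * QuotientGroup.mk g ∈ iwahoriBar F := by
    have := mul_mem hp hg
    rwa [show p⁻¹ * (QuotientGroup.mk g₀ : GL2ModCenter F) *
      ((QuotientGroup.mk g₀ : GL2ModCenter F)⁻¹ * QuotientGroup.mk g) =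
      p⁻¹ * QuotientGroup.mk g by group] at this
  rcases exists_pt_of_upper g₀ rfl rfl with ⟨m, x, hx, h⟩ | ⟨m, x, hx, h⟩ | ⟨m, x, hx, h⟩
  · exact Or.inl ⟨m, x, hx, key _ h⟩
  · exact Or.inr (Or.inl ⟨m, x, hx, key _ h⟩)
  · exact Or.inr (Or.inr ⟨m, x, hx, key _ h⟩)

variable (F) in
/-- Powers of `omBar`, indexed by parity. -/
def omPow (e : Bool) : GL2ModCenter F := if e then omBar F else 1

variable (F) in
/-- Index set of the cosets of the Iwahori subgroup in `G/Z`. -/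
abbrev CosetIdx : Type _ := Σ p : (Bool × Bool) × ℕ, reps F (p.2 + p.1.1.toNat)

/-- Representatives of the cosets of the Iwahori subgroup in `G/Z`. -/
def cosetRep (i : CosetIdx F) : GL2ModCenter F :=
  omPow F i.1.1.1 * pt i.2.1 (i.1.2 + i.1.1.1.toNat) * omPow F i.1.1.2

/-- If |d| ≤ |c|, right multiplication by ω sends the bottom row to (ϖd, c), which satisfies the
strict inequality of the previous case. -/
lemma exists_cosetRep (q : GL2ModCenter F) :
    ∃ i : CosetIdx F, (cosetRep i)⁻¹ * q ∈ iwahoriBar F := by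
  obtain ⟨g, rfl⟩ := QuotientGroup.mk_surjective q
  by_cases h : valuation F (g.1 1 0) < valuation F (g.1 1 1)
  · rcases exists_pt_of_lt g h with ⟨m, x, hx, h⟩ | ⟨m, x, hx, h⟩ | ⟨m, x, hx, h⟩
    · exact ⟨⟨((false, false), m), x, hx⟩, by simpa [cosetRep, omPow] using h⟩
    · exact ⟨⟨((true, false), m), x, hx⟩, by simpa [cosetRep, omPow] using h⟩
    · exact ⟨⟨((true, true), m), x, hx⟩, by simpa [cosetRep, omPow] using h⟩
  · have h' : valuation F ((g * om F).1 1 0) < valuation F ((g * om F).1 1 1) := by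
      push Not at h
      rw [eq_mat g, om, mat_mul_mat]
      simp only [val_mat, Matrix.of_apply, Matrix.cons_val', Matrix.cons_val_zero, Matrix.cons_val_one,
    Matrix.cons_val_fin_one]
      have hc : 0 < valuation F (g.1 1 0) := by
        rw [zero_lt_iff, Valuation.ne_zero_iff]
        intro hc
        rw [hc, map_zero, nonpos_iff_eq_zero, map_eq_zero] at h
        exact det_entries_ne_zero g (by rw [hc, h]; ring)
      simp only [mul_zero, zero_add, mul_one, add_zero, map_mul]
      calc _ ≤ valuation F (g.1 1 0) * valuation F (unif F) := by gcongr
        _ < valuation F (g.1 1 0) * 1 := mul_lt_mul_of_pos_left valuation_unif_lt_one hc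
        _ = _ := mul_one _
    have key (p : GL2ModCenter F) (hp : p⁻¹ * QuotientGroup.mk (g * om F) ∈ iwahoriBar F) :
        (p * omBar F)⁻¹ * QuotientGroup.mk g ∈ iwahoriBar F := by
      rw [← omBar_conj_mem_iff, mul_inv_rev, omBar_inv]
      rw [QuotientGroup.mk_mul] at hp
      rwa [show omBar F * (omBar F * p⁻¹ * QuotientGroup.mk g) * omBar F =
        (omBar F * omBar F) * (p⁻¹ * (QuotientGroup.mk g * omBar F)) by group, omBar_mul_self,
        one_mul]
    rcases exists_pt_of_lt _ h' with ⟨m, x, hx, h⟩ | ⟨m, x, hx, h⟩ | ⟨m, x, hx, h⟩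
    · exact ⟨⟨((false, true), m), x, hx⟩, by simpa [cosetRep, omPow] using key _ h⟩
    · exact ⟨⟨((true, true), m), x, hx⟩, by simpa [cosetRep, omPow] using key _ h⟩
    · exact ⟨⟨((true, false), m), x, hx⟩, by
        simpa [cosetRep, omPow, mul_assoc, omBar_mul_self, omBar_inv] using key _ h⟩

lemma omPow_conj_mem_iff (p p' : GL2ModCenter F) (e d e' d' : Bool) :
    (omPow F e * p * omPow F d)⁻¹ * (omPow F e' * p' * omPow F d') ∈ iwahoriBar F ↔
      p⁻¹ * (omPow F (xor e e') * p' * omPow F (xor d d')) ∈ iwahoriBar F := by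
  have h1 (a : GL2ModCenter F) : omBar F * (omBar F * a) = a := by
    rw [← mul_assoc, omBar_mul_self, one_mul]
  cases d
  · cases e <;> cases e' <;> cases d' <;> simp [omPow, mul_assoc, omBar_inv, h1]
  · conv_lhs => rw [← omBar_conj_mem_iff]
    cases e <;> cases e' <;> cases d' <;>
      simp [omPow, mul_assoc, omBar_inv, h1, omBar_mul_self]

/-- Since ω has order two in G/Z and normalizes the image of I, only the sums modulo 2 of the
exponents of ω matter. The left exponent is compared first, then the right one, then n and the class
of x. -/
lemma cosetRep_injective {i j : CosetIdx F} (h : (cosetRep i)⁻¹ * cosetRep j ∈ iwahoriBar F) :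
    i = j := by
  have aux {x y : F} {m n : ℕ} (hx : valuation F x ≤ 1) (hy : valuation F y ≤ 1) (d d' : Bool) :
      (omPow F false * pt x m * omPow F d)⁻¹ * (omPow F true * pt y (n + 1) * omPow F d') ∉
        iwahoriBar F := by
    rw [omPow_conj_mem_iff]
    cases h : xor d d'
    · simpa [omPow, h] using pt_inv_mul_omBar_mul_pt_notMem hx hy
    · intro hm
      have := pt_inv_mul_omBar_mul_pt_mul_omBar_mem hx hy (by simpa [omPow, h] using hm)
      lia
  obtain ⟨⟨⟨e, d⟩, m⟩, x, hx⟩ := i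
  obtain ⟨⟨⟨e', d'⟩, n⟩, y, hy⟩ := j
  have hx1 := valuation_le_one_of_mem_reps hx
  have hy1 := valuation_le_one_of_mem_reps hy
  by_cases he : e = e'
  · subst he
    have h2 := (omPow_conj_mem_iff _ _ _ _ _ _).1 h
    by_cases hd : d = d'
    · subst hd
      simp only [omPow, bne_self_eq_false, Bool.false_eq_true, if_false, one_mul, mul_one] at h2
      obtain ⟨h3, h4⟩ := pt_inv_mul_pt_mem_iff.1 h2
      obtain rfl : m = n := by simpa using h3
      obtain rfl : x = y := eq_of_mem_reps hx hy h4
      rfl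
    · have hd' : xor d d' = true := by simpa using hd
      rw [hd'] at h2
      refine absurd h2 ?_
      simpa [omPow] using pt_inv_mul_pt_mul_omBar_notMem
  · cases e <;> cases e' <;> simp only [reduceCtorEq, not_true_eq_false] at he
    · exact absurd h (aux hx1 hy1 d d')
    · refine absurd ?_ (aux (m := n) (n := m) hy1 hx1 d' d)
      have := inv_mem h
      rwa [mul_inv_rev, inv_inv] at this

end Reps

/-! ### The Iwahori subgroup is compact and open. -/

section Topology

variable {F : Type*} [Field F] [ValuativeRel F] [TopologicalSpace F]
    [IsNonarchimedeanLocalField F]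

lemma continuous_entry (i j : Fin 2) : Continuous fun g : GL2 F => g.1 i j :=
  Units.continuous_val.matrix_elem i j

lemma continuous_uni : Continuous (uni : F → GL2 F) := by
  refine Units.continuous_iff.2 ⟨?_, ?_⟩
  · change Continuous fun x : F => !![1, x; 0, 1]
    refine continuous_matrix fun i j => ?_
    fin_cases i <;> fin_cases j <;> simp <;> fun_prop
  · have : (fun x : F => ((uni x)⁻¹ : GL2 F).1) = fun x => !![1, -x; 0, 1] := by
      funext x
      rw [uni, mat_inv, val_mat]
      simp
    change Continuous fun x : F => ((uni x)⁻¹ : GL2 F).1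
    rw [this]
    refine continuous_matrix fun i j => ?_
    fin_cases i <;> fin_cases j <;> simp <;> fun_prop

lemma uni_zero : uni (0 : F) = 1 := by
  apply Units.ext
  rw [uni, val_mat, Units.val_one]
  ext i j; fin_cases i <;> fin_cases j <;> rfl

/-- An open subgroup contains the unipotent elements close to `1`. -/
lemma exists_uni_mem_of_isOpen {U : Subgroup (GL2 F)} (hU : IsOpen (U : Set (GL2 F))) :
    ∃ N : ℕ, ∀ x : F, valuation F x ≤ valuation F (unif F) ^ N → uni x ∈ U := by
  have h : (uni : F → GL2 F) ⁻¹' U ∈ nhds (0 : F) := by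
    refine (hU.preimage continuous_uni).mem_nhds ?_
    simp [uni_zero, one_mem]
  obtain ⟨N, -, hN⟩ := hasBasis_nhds_zero.mem_iff.1 h
  exact ⟨N, fun x hx => hN hx⟩

lemma isOpen_iwahoriSubgroup : IsOpen (iwahoriSubgroup F : Set (GL2 F)) := by
  let S : Set F := {x : F | valuation F x ≤ valuation F (unif F) ^ 1}
  have hS : IsOpen S := isOpen_valuation_le 1
  refine (iwahoriSubgroup F).isOpen_of_mem_nhds (g := 1) ?_
  have h (i j : Fin 2) (a : F) (ha : (1 : GL2 F).1 i j = a) :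
      ∀ᶠ g : GL2 F in nhds 1, g.1 i j - a ∈ S := by
    refine ((continuous_entry i j).sub continuous_const).continuousAt.eventually
      (hS.mem_nhds ?_)
    change (1 : GL2 F).1 i j - a ∈ S
    rw [ha, sub_self]; simp [S]
  filter_upwards [h 0 0 1 (by simp), h 1 1 1 (by simp), h 0 1 0 (by simp), h 1 0 0 (by simp)]
    with g h1 h2 h3 h4
  simp only [S, Set.mem_ofPred_eq, pow_one, valuation_le_unif_iff, sub_zero] at h1 h2 h3 h4
  refine ⟨?_, ?_, h3.le, h4⟩
  · rw [show g.1 0 0 = (g.1 0 0 - 1) + 1 by ring, Valuation.map_add_eq_of_lt_right, map_one]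
    rwa [map_one]
  · rw [show g.1 1 1 = (g.1 1 1 - 1) + 1 by ring, Valuation.map_add_eq_of_lt_right, map_one]
    rwa [map_one]

/-- The topology of G is induced by g ↦ (g, g⁻¹), a closed embedding, and both components of an
element of I have entries in the compact ring 𝒪. An open subgroup is closed. -/
lemma isCompact_iwahoriSubgroup : IsCompact (iwahoriSubgroup F : Set (GL2 F)) := by
  have : T2Space (Matrix (Fin 2) (Fin 2) F) :=
    inferInstanceAs (T2Space (Fin 2 → Fin 2 → F))
  let C : Set (Matrix (Fin 2) (Fin 2) F) :=
    Set.univ.pi fun _ => Set.univ.pi fun _ => {x : F | valuation F x ≤ 1}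
  have hC : IsCompact C := isCompact_univ_pi fun _ => isCompact_univ_pi fun _ =>
    IsNonarchimedeanLocalField.isCompact_closedBall F 1
  have hCop : IsCompact (MulOpposite.unop ⁻¹' C : Set (Matrix (Fin 2) (Fin 2) F)ᵐᵒᵖ) := by
    rw [← MulOpposite.opHomeomorph.symm.isCompact_image] 
    convert hC
    exact Set.image_preimage_eq _ MulOpposite.unop_surjective
  have hK := (Units.isClosedEmbedding_embedProduct (α := Matrix (Fin 2) (Fin 2) F)).isCompact_preimage
    (hC.prod hCop)
  have hle (g : GL2 F) (hg : g ∈ iwahori F) : g.1 ∈ C := by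
    obtain ⟨h1, h2, h3, h4⟩ := hg
    intro i _ j _
    fin_cases i <;> fin_cases j
    exacts [h1.le, h3, h4.le, h2.le]
  refine hK.of_isClosed_subset ((iwahoriSubgroup F).isClosed_of_isOpen isOpen_iwahoriSubgroup) ?_
  intro g hg
  exact ⟨hle g hg, hle g⁻¹ (inv_mem hg)⟩

instance : CompactSpace (iwahoriSubgroup F) := isCompact_iff_compactSpace.1 isCompact_iwahoriSubgroup

/-- Open subgroups of `G` have finite index in the Iwahori subgroup. -/
lemma finite_quotient_iwahoriSubgroup {U : Subgroup (GL2 F)} (hU : IsOpen (U : Set (GL2 F))) :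
    Finite (iwahoriSubgroup F ⧸ U.subgroupOf (iwahoriSubgroup F)) :=
  Subgroup.quotient_finite_of_isOpen _ (hU.preimage continuous_subtype_val)

lemma isOpen_iwahoriBar : IsOpen (iwahoriBar F : Set (GL2ModCenter F)) :=
  QuotientGroup.isOpenMap_coe _ isOpen_iwahoriSubgroup

lemma isCompact_iwahoriBar : IsCompact (iwahoriBar F : Set (GL2ModCenter F)) :=
  isCompact_iwahoriSubgroup.image QuotientGroup.continuous_mk

end Topology

/-! ### Positive characters of GL(2) trivial on the centre. -/

section Unimodular

variable {F : Type*} [Field F]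

/-- A positive character of `GL(2, F)` that is trivial on the centre is trivial. -/
lemma monoidHom_nnreal_eq_one (φ : GL2 F →* NNReal)
    (hφ : ∀ z ∈ Subgroup.center (GL2 F), φ z = 1) {t : F} (ht0 : t ≠ 0) (ht1 : t ≠ 1) (g : GL2 F) :
    φ g = 1 := by
  have hpos (g : GL2 F) : φ g ≠ 0 := by
    intro h
    have := map_mul φ g g⁻¹
    rw [mul_inv_cancel, map_one, h, zero_mul] at this
    exact one_ne_zero this
  have hsq (g : GL2 F) (h : φ g * φ g = 1) : φ g = 1 := by
    rw [← sq] at h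
    exact (pow_eq_one_iff_of_nonneg zero_le two_ne_zero).1 h
  let s : GL2 F := mat 0 1 1 0 (by simp)
  let δ (a : F) (ha : a ≠ 0) : GL2 F := mat a 0 0 1 (by simpa using ha)
  let z (a : F) (ha : a ≠ 0) : GL2 F := mat a 0 0 a (by simpa using ha)
  have hz (a ha) : φ (z a ha) = 1 := hφ _ (mem_center_of_eq_scalar (val_mat _ _ _ _ _))
  have hs : φ s = 1 := by
    refine hsq _ ?_
    rw [← map_mul, ← hz 1 one_ne_zero]
    congr 1
    simp only [s, z, mat_mul_mat]; congr 1 <;> simp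
  -- The product of diag(a, 1) with its conjugate diag(1, a) by the Weyl element is scalar.
  have hδ (a ha) : φ (δ a ha) = 1 := by
    refine hsq _ ?_
    calc φ (δ a ha) * φ (δ a ha) = φ (δ a ha * (s * δ a ha * s)) := by
          rw [map_mul, map_mul, map_mul, hs, one_mul, mul_one]
      _ = φ (z a ha) := by
          congr 1
          simp only [s, z, δ, mat_mul_mat]; congr 1 <;> simp
      _ = 1 := hz _ ha
  -- Every unipotent element is a commutator with diag(t, 1); dividing by t - 1 is where t ≠ 1
  -- enters.
  have hu (x : F) : φ (uni x) = 1 := by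
    have h1 : δ t ht0 * uni (x / (t - 1)) = uni x * uni (x / (t - 1)) * δ t ht0 := by
      have : t - 1 ≠ 0 := sub_ne_zero.2 ht1
      simp only [uni, δ, mat_mul_mat]; congr 1 <;> simp
      field_simp; ring
    have h2 := congrArg φ h1
    rw [map_mul, map_mul, map_mul, hδ t ht0, one_mul, mul_one] at h2
    exact (mul_eq_right₀ (hpos _)).1 h2.symm
  have hB (a b d : F) (h : a * d - b * 0 ≠ 0) : φ (mat a b 0 d h) = 1 := by
    have ha : a ≠ 0 := by rintro rfl; simp at h
    have hd : d ≠ 0 := by rintro rfl; simp at h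
    have : mat a b 0 d h = z d hd * (uni (b / d) * δ (a / d) (div_ne_zero ha hd)) := by
      simp only [z, uni, δ, mat_mul_mat]; congr 1 <;> simp <;> field_simp
    rw [this, map_mul, map_mul, hz _ hd, hu, hδ _ (div_ne_zero ha hd), one_mul, one_mul]
  obtain ⟨a, b, c, d, h, rfl⟩ : ∃ a b c d h, g = mat a b c d h := ⟨_, _, _, _, _, eq_mat g⟩
  by_cases hc : c = 0
  · subst hc; exact hB _ _ _ _
  -- Bruhat decomposition: for c ≠ 0 the matrix is a unipotent times the Weyl element times an upper
  -- triangular matrix.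
  · have h' : c * (b - a / c * d) - d * 0 ≠ 0 := by
      convert neg_ne_zero.2 h using 1; field_simp; ring
    have : mat a b c d h = uni (a / c) * (s * mat c d 0 (b - a / c * d) h') := by
      simp only [uni, s, mat_mul_mat]; congr 1 <;> simp; field_simp
    rw [this, map_mul, map_mul, hs, hu, hB, one_mul, one_mul]

end Unimodular

/-! ### Haar measure on G/Z: unimodularity and integration over cosets. -/

section Haar

variable {F : Type*} [Field F] [ValuativeRel F] [TopologicalSpace F]
    [IsNonarchimedeanLocalField F]
    [MeasurableSpace (GL2ModCenter F)] [BorelSpace (GL2ModCenter F)]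
    (μ : Measure (GL2ModCenter F)) [μ.IsHaarMeasure]

instance isMulRightInvariant_haar : μ.IsMulRightInvariant where
  map_mul_right_eq_self q := by
    -- Right translation scales μ by the modular character, whose pullback to G is positive and
    -- trivial on the centre, hence trivial.
    have h := Measure.isMulLeftInvariant_eq_smul (Measure.map (· * q) μ) μ
    rw [← Measure.modularCharacterFun_eq_haarScalarFactor μ q] at h
    rw [h]
    have := monoidHom_nnreal_eq_one
      ((Measure.modularCharacter (G := GL2ModCenter F)).comp (QuotientGroup.mk' _))
      (fun z hz => by
        rw [MonoidHom.comp_apply, QuotientGroup.mk'_apply, (QuotientGroup.eq_one_iff z).2 hz,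
          map_one]) (unif_ne_zero F) (by
        intro h; have := valuation_unif_lt_one (F := F); simp [h] at this) q.out
    rw [MonoidHom.comp_apply, QuotientGroup.mk'_apply, QuotientGroup.out_eq'] at this
    change Measure.modularCharacterFun q = 1 at this
    rw [this, one_smul]

lemma measure_iwahoriBar_ne_zero : μ (iwahoriBar F) ≠ 0 :=
  isOpen_iwahoriBar.measure_ne_zero μ ⟨1, one_mem _⟩

lemma measure_iwahoriBar_ne_top : μ (iwahoriBar F) ≠ ⊤ :=
  isCompact_iwahoriBar.measure_ne_top

/-- By right invariance of μ its image under inversion is left invariant, hence a multiple of μ. The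
factor is 1 because the image of I is stable under inversion and has finite nonzero measure. -/
instance isInvInvariant_haar : μ.IsInvInvariant where
  inv_eq_self := by
    have h := Measure.isMulLeftInvariant_eq_smul μ.inv μ
    have h2 := congrArg (fun ν : Measure (GL2ModCenter F) => ν (iwahoriBar F)) h
    have h3 : ((iwahoriBar F : Set (GL2ModCenter F)))⁻¹ = iwahoriBar F := inv_coe_set
    rw [Measure.inv_apply, h3, Measure.smul_apply, ENNReal.smul_def, smul_eq_mul] at h2
    have h4 := (ENNReal.mul_eq_right (measure_iwahoriBar_ne_zero μ)
      (measure_iwahoriBar_ne_top μ)).1 h2.symm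
    rw [h, ENNReal.coe_eq_one.1 h4, one_smul]

open scoped Pointwise in
/-- Integration over `G/Z` of a function right invariant under the Iwahori subgroup. -/
lemma lintegral_eq_tsum_cosetRep (h : GL2ModCenter F → ENNReal)
    (hh : ∀ q, ∀ k ∈ iwahoriBar F, h (q * k) = h q) :
    ∫⁻ q, h q ∂μ = μ (iwahoriBar F) * ∑' i : CosetIdx F, h (cosetRep i) := by
  let s (i : CosetIdx F) : Set (GL2ModCenter F) := cosetRep i • (iwahoriBar F : Set (GL2ModCenter F))
  have hs (i) (q) : q ∈ s i ↔ (cosetRep i)⁻¹ * q ∈ iwahoriBar F := by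
    simp [s, Set.mem_smul_set_iff_inv_smul_mem]
  have hU : ⋃ i, s i = Set.univ := by
    refine Set.eq_univ_of_forall fun q => ?_
    obtain ⟨i, hi⟩ := exists_cosetRep q
    exact Set.mem_iUnion.2 ⟨i, (hs i q).2 hi⟩
  have hdisj : Pairwise (Function.onFun Disjoint s) := by
    intro i j hij
    refine Set.disjoint_left.2 fun q hi hj => hij (cosetRep_injective ?_)
    have := mul_mem ((hs i q).1 hi) (inv_mem ((hs j q).1 hj))
    rwa [mul_inv_rev, inv_inv, mul_assoc, mul_inv_cancel_left] at this
  have hm (i) : MeasurableSet (s i) := (isOpen_iwahoriBar.smul (cosetRep i)).measurableSet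
  rw [← setLIntegral_univ, ← hU, lintegral_iUnion hm hdisj, ← ENNReal.tsum_mul_left]
  refine tsum_congr fun i => ?_
  have : ∫⁻ q in s i, h q ∂μ = ∫⁻ _ in s i, h (cosetRep i) ∂μ := by
    refine setLIntegral_congr_fun (hm i) fun q hq => ?_
    have := hh (cosetRep i) _ ((hs i q).1 hq)
    rwa [mul_inv_cancel_left] at this
  rw [this, setLIntegral_const, measure_smul, mul_comm]

end Haar

/-! ### The induced and Steinberg representations. -/

section Induced

variable {F : Type*} [Field F] [TopologicalSpace F] [IsTopologicalDivisionRing F]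

variable (F) in
/-- The space of `Ind_B^G 1`. -/
abbrev IndSpace : Type _ :=
  SmoothInd (borelSubgroup F) (Representation.trivial ℂ (borelSubgroup F) ℂ)

variable (F) in
/-- The representation `Ind_B^G 1`. -/
abbrev indRep : Representation ℂ (GL2 F) (IndSpace F) :=
  smoothInd (borelSubgroup F) (Representation.trivial ℂ (borelSubgroup F) ℂ)

variable (F) in
/-- The space of the Steinberg representation. -/
abbrev StSpace : Type _ := IndSpace F ⧸ constantFunctions F

lemma indSpace_borel_mul (f : IndSpace F) {b : GL2 F} (hb : b.1 1 0 = 0) (g : GL2 F) :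
    f.1 (b * g) = f.1 g := f.2.1 ⟨b, hb⟩ g

lemma indRep_apply (g : GL2 F) (f : IndSpace F) (x : GL2 F) : (indRep F g f).1 x = f.1 (x * g) :=
  rfl

lemma steinberg_mk (g : GL2 F) (f : IndSpace F) :
    steinberg F g ((constantFunctions F).mkQ f) = (constantFunctions F).mkQ (indRep F g f) := rfl

lemma indSpace_mul_center (f : IndSpace F) {z : GL2 F} (hz : z ∈ Subgroup.center (GL2 F))
    (g : GL2 F) : f.1 (g * z) = f.1 g := by
  rw [← Subgroup.mem_center_iff.1 hz g |>.symm]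
  obtain ⟨c, -, h⟩ := center_eq_scalar hz
  exact indSpace_borel_mul f (by rw [h]; rfl) g

lemma steinberg_center {z : GL2 F} (hz : z ∈ Subgroup.center (GL2 F)) (v : StSpace F) :
    steinberg F z v = v := by
  obtain ⟨f, rfl⟩ := (constantFunctions F).mkQ_surjective v
  rw [steinberg_mk]
  congr 1
  ext x
  exact indSpace_mul_center f hz x

/-- Every vector of the Steinberg representation is smooth. -/
lemma exists_isOpen_steinberg_fixed (v : StSpace F) :
    ∃ U : Subgroup (GL2 F), IsOpen (U : Set (GL2 F)) ∧ ∀ k ∈ U, steinberg F k v = v := by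
  obtain ⟨f, rfl⟩ := (constantFunctions F).mkQ_surjective v
  obtain ⟨U, hU, h⟩ := f.2.2
  refine ⟨U, hU, fun k hk => ?_⟩
  rw [steinberg_mk]
  congr 1
  ext x
  exact h x k hk

end Induced

/-! ### The disc vector: symmetries, subdivision and generation. -/

section Disc

variable {F : Type*} [Field F] [ValuativeRel F] [TopologicalSpace F]
    [IsNonarchimedeanLocalField F]

open Classical in
/-- The indicator function of the bottom rows `(c, d)` with `|d| ≤ |c|`. -/
def discFun {F : Type*} [Field F] [ValuativeRel F] (g : GL2 F) : ℂ :=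
  if valuation F (g.1 1 1) ≤ valuation F (g.1 1 0) then 1 else 0

lemma mul_row (g h : GL2 F) (j : Fin 2) :
    (g * h).1 1 j = g.1 1 0 * h.1 0 j + g.1 1 1 * h.1 1 j := by
  rw [Units.val_mul, Matrix.mul_apply, Fin.sum_univ_two]

lemma bottom_ne_zero (g : GL2 F) (h : g.1 1 0 = 0) : g.1 1 1 ≠ 0 := by
  intro h'
  have := det_entries_ne_zero g
  rw [h, h'] at this; simp at this

lemma discFun_borel_mul {b : GL2 F} (hb : b.1 1 0 = 0) (g : GL2 F) :
    discFun (b * g) = discFun g := by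
  have hd : 0 < valuation F (b.1 1 1) := by
    rw [zero_lt_iff, Valuation.ne_zero_iff]; exact bottom_ne_zero b hb
  simp only [discFun, mul_row, hb, zero_mul, zero_add, map_mul]
  congr 1
  rw [mul_le_mul_iff_right₀ hd]

/-- It is the complement |c| < |d| that is checked to be stable under I; applying this to k and k⁻¹
gives invariance. -/
lemma discFun_mul_iwahori (g : GL2 F) {k : GL2 F} (hk : k ∈ iwahoriSubgroup F) :
    discFun (g * k) = discFun g := by
  have key (g k : GL2 F) (hk : k ∈ iwahori F)
      (h : valuation F (g.1 1 0) < valuation F (g.1 1 1)) :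
      valuation F ((g * k).1 1 0) < valuation F ((g * k).1 1 1) := by
    obtain ⟨h1, h2, h3, h4⟩ := hk
    have h0 : 0 < valuation F (g.1 1 1) := lt_of_le_of_lt zero_le h
    rw [mul_row, mul_row, Valuation.map_add_eq_of_lt_right (x := g.1 1 0 * k.1 0 1)]
    · refine (valuation F).map_add_lt ?_ ?_
      · simpa [h1, h2] using h
      · rw [map_mul, map_mul]; exact (mul_lt_mul_of_pos_left (by rwa [h2]) h0)
    · rw [map_mul, map_mul, h2, mul_one]
      exact (mul_le_of_le_one_right' h3).trans_lt h
  simp only [discFun]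
  congr 1
  rw [eq_iff_iff, ← not_iff_not, not_le, not_le]
  refine ⟨fun h => ?_, key g k hk⟩
  simpa using key (g * k) k⁻¹ (inv_mem hk) h

/-- ω sends the row (c, d) to (ϖd, c), and |c| ≤ |ϖd| means |c| < |d| by discreteness. -/
lemma discFun_mul_om (g : GL2 F) : discFun (g * om F) = 1 - discFun g := by
  have h0 : (g * om F).1 1 0 = g.1 1 1 * unif F := by
    rw [mul_row]; simp [om]
  have h1 : (g * om F).1 1 1 = g.1 1 0 := by
    rw [mul_row]; simp [om]
  simp only [discFun, h0, h1]
  by_cases h : valuation F (g.1 1 1) ≤ valuation F (g.1 1 0)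
  · have hc : 0 < valuation F (g.1 1 0) := by
      rw [zero_lt_iff, Valuation.ne_zero_iff]
      intro hc
      rw [hc, map_zero, nonpos_iff_eq_zero, map_eq_zero] at h
      exact bottom_ne_zero g hc h
    rw [if_pos h, if_neg, sub_self]
    rw [not_le, map_mul]
    calc _ ≤ valuation F (g.1 1 0) * valuation F (unif F) := by gcongr
      _ < valuation F (g.1 1 0) * 1 := mul_lt_mul_of_pos_left valuation_unif_lt_one hc
      _ = _ := mul_one _
  · rw [if_neg h, if_pos, sub_zero]
    push Not at h
    have hd : 0 < valuation F (g.1 1 1) := lt_of_le_of_lt zero_le h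
    have : valuation F (g.1 1 0 / g.1 1 1) < 1 := by rwa [map_div₀, div_lt_one₀ hd]
    rwa [← valuation_le_unif_iff, map_div₀, div_le_iff₀ hd, ← map_mul, mul_comm] at this

lemma discFun_mul_uni_mul_dia (g : GL2 F) (x : F) (n : ℕ) [Decidable
      (valuation F (g.1 1 0 * x + g.1 1 1) ≤ valuation F (g.1 1 0) * valuation F (unif F) ^ n)] :
    discFun (g * (uni x * dia F n)) =
      if valuation F (g.1 1 0 * x + g.1 1 1) ≤ valuation F (g.1 1 0) * valuation F (unif F) ^ n
        then 1 else 0 := by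
  have h0 : (g * (uni x * dia F n)).1 1 0 = g.1 1 0 * unif F ^ n := by
    rw [mul_row, uni_mul_dia]; simp
  have h1 : (g * (uni x * dia F n)).1 1 1 = g.1 1 0 * x + g.1 1 1 := by
    rw [mul_row, uni_mul_dia]; simp
  simp only [discFun, h0, h1, map_mul, map_pow]

/-- A representative of the point of the projective line with coordinate `y`. -/
def flag {F : Type*} [Field F] (y : F) : GL2 F := mat 0 1 1 y (by simp)

/-- A locally constant function on the disc is a combination of indicators of small discs. -/
lemma sum_reps_mul_discFun {f : GL2 F → ℂ} (hB : ∀ b g : GL2 F, b.1 1 0 = 0 → f (b * g) = f g)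
    {N : ℕ} (hN : ∀ g x, valuation F x ≤ valuation F (unif F) ^ N → f (g * uni x) = f g)
    (g : GL2 F) :
    ∑ x ∈ reps F N, f (flag (-x)) * discFun (g * (uni x * dia F N)) = f g * discFun g := by
  classical
  simp only [discFun_mul_uni_mul_dia]
  by_cases h : valuation F (g.1 1 1) ≤ valuation F (g.1 1 0)
  · have hc : g.1 1 0 ≠ 0 := by
      intro hc
      rw [hc, map_zero, nonpos_iff_eq_zero, map_eq_zero] at h
      exact bottom_ne_zero g hc h
    have hc0 : 0 < valuation F (g.1 1 0) := by rwa [zero_lt_iff, Valuation.ne_zero_iff]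
    have hdc : valuation F (-(g.1 1 1 / g.1 1 0)) ≤ 1 := by
      rw [Valuation.map_neg, map_div₀]; exact div_le_one_of_le₀ h zero_le
    have hiff (x : F) : valuation F (g.1 1 0 * x + g.1 1 1) ≤
        valuation F (g.1 1 0) * valuation F (unif F) ^ N ↔
        valuation F (-(g.1 1 1 / g.1 1 0) - x) ≤ valuation F (unif F) ^ N := by
      rw [show g.1 1 0 * x + g.1 1 1 = g.1 1 0 * -(-(g.1 1 1 / g.1 1 0) - x) by field_simp; ring,
        map_mul, Valuation.map_neg, mul_le_mul_iff_right₀ hc0]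
    obtain ⟨x, ⟨hx, hxy⟩, hu⟩ := existsUnique_mem_reps N hdc
    rw [Finset.sum_eq_single_of_mem x hx, if_pos ((hiff x).2 hxy), discFun, if_pos h, mul_one,
      mul_one]
    · have hy : valuation F (x + g.1 1 1 / g.1 1 0) ≤ valuation F (unif F) ^ N := by
        rwa [← Valuation.map_neg, show -(x + g.1 1 1 / g.1 1 0) = -(g.1 1 1 / g.1 1 0) - x by ring]
      -- Modulo B on the left, g is the flag with bottom row (1, d/c); it differs from the row (1,
      -- -x) by a unipotent so small that f does not see it.
      have hgd : g = mat (g.1 0 1 - g.1 0 0 * (g.1 1 1 / g.1 1 0)) (g.1 0 0) 0 (g.1 1 0) (by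
          convert neg_ne_zero.2 (det_entries_ne_zero g) using 1; field_simp; ring) *
          (flag (-x) * uni (x + g.1 1 1 / g.1 1 0)) := by
        conv_lhs => rw [eq_mat g]
        simp only [flag, uni, mat_mul_mat]; congr 1 <;> simp; field_simp
      conv_rhs => rw [hgd]
      rw [hB _ _ rfl, hN _ _ hy]
    · intro y hy hyx
      rw [if_neg, mul_zero]
      exact fun h => hyx (hu y ⟨hy, (hiff y).1 h⟩)
  · have h' := h
    push Not at h'
    rw [discFun, if_neg h, mul_zero]
    refine Finset.sum_eq_zero fun x hx => ?_
    rw [if_neg, mul_zero]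
    rw [not_le, Valuation.map_add_eq_of_lt_right]
    · exact (mul_le_of_le_one_right' (pow_le_one₀ zero_le valuation_unif_lt_one.le)).trans_lt h'
    · rw [map_mul]
      exact (mul_le_of_le_one_right' (valuation_le_one_of_mem_reps hx)).trans_lt h'

variable (F) in
/-- The indicator function of a disc as a vector of `Ind_B^G 1`. -/
def discInd : IndSpace F :=
  ⟨discFun, fun h g => discFun_borel_mul h.2 g, iwahoriSubgroup F, isOpen_iwahoriSubgroup,
    fun g _ hk => discFun_mul_iwahori g hk⟩

variable (F) in
/-- The Iwahori fixed vector of the Steinberg representation. -/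
def discVec : StSpace F := (constantFunctions F).mkQ (discInd F)

lemma steinberg_iwahori_discVec {k : GL2 F} (hk : k ∈ iwahoriSubgroup F) :
    steinberg F k (discVec F) = discVec F := by
  rw [discVec, steinberg_mk]
  congr 1
  ext x
  exact discFun_mul_iwahori x hk

lemma steinberg_om_discVec : steinberg F (om F) (discVec F) = -discVec F := by
  rw [discVec, steinberg_mk, ← sub_eq_zero, sub_neg_eq_add, ← map_add, Submodule.mkQ_apply,
    Submodule.Quotient.mk_eq_zero]
  refine ⟨1, fun g => ?_⟩
  change discFun (g * om F) + discFun g = 1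
  rw [discFun_mul_om, sub_add_cancel]

/-- Subdivision of the disc into q^n small discs, the case f = 1 of `sum_reps_mul_discFun`. -/
lemma sum_steinberg_discVec (n : ℕ) :
    ∑ x ∈ reps F n, steinberg F (uni x * dia F n) (discVec F) = discVec F := by
  simp only [discVec, steinberg_mk]
  rw [← map_sum]
  congr 1
  ext g
  have := sum_reps_mul_discFun (f := fun _ : GL2 F => (1 : ℂ)) (fun _ _ _ => rfl) (N := n)
    (fun _ _ _ => rfl) g
  simp only [one_mul] at this
  rw [AddSubmonoidClass.coe_finsetSum, Finset.sum_apply]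
  exact this

/-- Cut f into its parts on the disc and on the complement. The first is a combination of small
discs, and ω carries the second to the first kind. -/
lemma span_indRep_discInd :
    Submodule.span ℂ (Set.range fun g => indRep F g (discInd F)) = ⊤ := by
  refine eq_top_iff.2 fun f _ => ?_
  have key (f : IndSpace F) : ∃ t ∈ Submodule.span ℂ (Set.range fun g => indRep F g (discInd F)),
      ∀ g, t.1 g = f.1 g * discFun g := by
    obtain ⟨U, hU, h⟩ := f.2.2
    obtain ⟨N, hN⟩ := exists_uni_mem_of_isOpen hU
    refine ⟨∑ x ∈ reps F N, f.1 (flag (-x)) • indRep F (uni x * dia F N) (discInd F), ?_, ?_⟩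
    · exact Submodule.sum_mem _ fun x _ => Submodule.smul_mem _ _ (Submodule.subset_span ⟨_, rfl⟩)
    · intro g
      rw [AddSubmonoidClass.coe_finsetSum, Finset.sum_apply]
      exact sum_reps_mul_discFun (fun b g hb => indSpace_borel_mul f hb g)
        (fun g x hx => h g _ (hN x hx)) g
  obtain ⟨t, ht, h1⟩ := key f
  obtain ⟨t', ht', h2⟩ := key (indRep F (om F) f)
  have : f = t + indRep F (om F) t' := by
    ext g
    change f.1 g = t.1 g + t'.1 (g * om F)
    have hom : om F * om F ∈ Subgroup.center (GL2 F) := by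
      rw [om_mul_self]; exact mem_center_of_eq_scalar (val_mat _ _ _ _ _)
    rw [h1, h2, discFun_mul_om, indRep_apply, mul_assoc, indSpace_mul_center f hom]
    ring
  rw [this]
  refine Submodule.add_mem _ ht ?_
  have hle : (Submodule.span ℂ (Set.range fun g => indRep F g (discInd F))).map (indRep F (om F)) ≤
      Submodule.span ℂ (Set.range fun g => indRep F g (discInd F)) := by
    rw [Submodule.map_span_le]
    rintro _ ⟨g, rfl⟩
    refine Submodule.subset_span ⟨om F * g, ?_⟩
    change indRep F (om F * g) (discInd F) = _
    rw [map_mul]; rfl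
  exact hle (Submodule.mem_map_of_mem ht')

lemma span_steinberg_discVec :
    Submodule.span ℂ (Set.range fun g => steinberg F g (discVec F)) = ⊤ := by
  have := congrArg (Submodule.map (constantFunctions F).mkQ) (span_indRep_discInd (F := F))
  rw [Submodule.map_span, Submodule.map_top, Submodule.range_mkQ, ← Set.range_comp] at this
  exact this

end Disc

/-! ### Matrix coefficients as functions on G/Z. -/

section Coefficients

variable {F : Type*} [Field F] [TopologicalSpace F] [IsTopologicalDivisionRing F]

variable (F) in
/-- The full dual of the Steinberg representation. -/
abbrev StDual : Type _ := Module.Dual ℂ (StSpace F)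

/-- The matrix coefficient `g ↦ ⟨w', π(g) v⟩` as a function on `G/Z`. -/
def coeff (w' : StDual F) (v : StSpace F) (q : GL2ModCenter F) : ℂ := w' (steinberg F q.out v)

lemma coeff_mk (w' : StDual F) (v : StSpace F) (g : GL2 F) :
    coeff w' v (QuotientGroup.mk g) = w' (steinberg F g v) := by
  obtain ⟨z, hz⟩ := QuotientGroup.mk_out_eq_mul (Subgroup.center (GL2 F)) g
  rw [coeff, hz, map_mul, Module.End.mul_apply, steinberg_center z.2]

lemma coeff_mul_mk (w' : StDual F) (v : StSpace F) (q : GL2ModCenter F) (h : GL2 F) :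
    coeff w' v (q * QuotientGroup.mk h) = coeff w' (steinberg F h v) q := by
  obtain ⟨g, rfl⟩ := QuotientGroup.mk_surjective q
  rw [← QuotientGroup.mk_mul, coeff_mk, coeff_mk, map_mul, Module.End.mul_apply]

lemma coeff_mk_mul (w' : StDual F) (v : StSpace F) (q : GL2ModCenter F) (h : GL2 F) :
    coeff w' v (QuotientGroup.mk h * q) = coeff ((steinberg F).dual h⁻¹ w') v q := by
  obtain ⟨g, rfl⟩ := QuotientGroup.mk_surjective q
  rw [← QuotientGroup.mk_mul, coeff_mk, coeff_mk, map_mul, Module.End.mul_apply,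
    Representation.dual_apply, inv_inv]
  rfl

lemma dual_steinberg_apply (w' : StDual F) (v : StSpace F) (g : GL2 F) :
    (steinberg F).dual g w' v = w' (steinberg F g⁻¹ v) := rfl

lemma coeff_add_right (w' : StDual F) (v w : StSpace F) :
    coeff w' (v + w) = coeff w' v + coeff w' w := by
  funext q; simp [coeff]

lemma coeff_smul_right (w' : StDual F) (c : ℂ) (v : StSpace F) :
    coeff w' (c • v) = c • coeff w' v := by
  funext q; simp [coeff]

lemma coeff_add_left (w' v' : StDual F) (v : StSpace F) :
    coeff (w' + v') v = coeff w' v + coeff v' v := by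
  funext q; simp [coeff]

lemma coeff_smul_left (c : ℂ) (w' : StDual F) (v : StSpace F) :
    coeff (c • w') v = c • coeff w' v := by
  funext q; simp [coeff]

lemma continuous_coeff (w' : StDual F) (v : StSpace F) : Continuous (coeff w' v) := by
  obtain ⟨U, hU, h⟩ := exists_isOpen_steinberg_fixed v
  have : Continuous fun g : GL2 F => coeff w' v (QuotientGroup.mk g) := by
    refine IsLocallyConstant.continuous ((IsLocallyConstant.iff_eventually_eq _).2 fun g => ?_)
    have hg : (fun x => g⁻¹ * x) ⁻¹' U ∈ nhds g :=
      (hU.preimage (continuous_const_mul g⁻¹)).mem_nhds (by simp [one_mem])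
    filter_upwards [hg] with x hx
    have := h _ hx
    rw [coeff_mk, coeff_mk]
    conv_rhs => rw [← this]
    rw [← Module.End.mul_apply, ← map_mul, mul_inv_cancel_left]
  exact QuotientGroup.isOpenQuotientMap_mk.isQuotientMap.continuous_iff.2 this

lemma dual_mem_smoothDual {w' : StDual F} (hw : w' ∈ smoothDual (steinberg F)) (g : GL2 F) :
    (steinberg F).dual g w' ∈ smoothDual (steinberg F) := by
  obtain ⟨U, hU, h⟩ := hw
  refine ⟨U.comap (MulAut.conj g⁻¹).toMonoidHom, ?_, fun k hk => ?_⟩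
  · have hc : Continuous fun x : GL2 F => g⁻¹ * x * g⁻¹⁻¹ := by fun_prop
    exact hU.preimage hc
  · have hk' : g⁻¹ * k * g ∈ U := by simpa using hk
    have := congrArg ((steinberg F).dual g) (h _ hk')
    rw [← Module.End.mul_apply, ← map_mul] at this
    rwa [← Module.End.mul_apply, ← map_mul, show k * g = g * (g⁻¹ * k * g) by group]

end Coefficients

/-! ### Iwahori-fixed functionals: explicit coefficients and uniqueness. -/

section IwahoriFixed

variable {F : Type*} [Field F] [ValuativeRel F] [TopologicalSpace F]
    [IsNonarchimedeanLocalField F]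

/-- A linear functional on the Steinberg representation is fixed by the Iwahori subgroup. -/
def IsIwahoriFixed (w' : StDual F) : Prop :=
  ∀ k ∈ iwahoriSubgroup F, ∀ v, w' (steinberg F k v) = w' v

lemma IsIwahoriFixed.apply_of_mk_mem {w' : StDual F} (hw : IsIwahoriFixed w') {g : GL2 F}
    (hg : (QuotientGroup.mk g : GL2ModCenter F) ∈ iwahoriBar F) (v : StSpace F) :
    w' (steinberg F g v) = w' v := by
  obtain ⟨k, hk, h⟩ := hg
  rw [← coeff_mk, ← h, QuotientGroup.mk'_apply, coeff_mk, hw k hk]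

lemma coeff_discVec_mul (w' : StDual F) (q : GL2ModCenter F) {k : GL2ModCenter F}
    (hk : k ∈ iwahoriBar F) : coeff w' (discVec F) (q * k) = coeff w' (discVec F) q := by
  obtain ⟨k, hk, rfl⟩ := hk
  rw [QuotientGroup.mk'_apply, coeff_mul_mk, steinberg_iwahori_discVec hk]

lemma uni_mem_iwahori {x : F} (hx : valuation F x ≤ 1) : uni x ∈ iwahoriSubgroup F := by
  change uni x ∈ iwahori F
  simp [iwahori, uni, hx]

/-- Apply the functional to the subdivision of the disc: the unipotents `uni x` with x integral lie
in I, so the q^n terms are equal. -/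
lemma IsIwahoriFixed.apply_uni_mul_dia {w' : StDual F} (hw : IsIwahoriFixed w') {x : F}
    (hx : valuation F x ≤ 1) (n : ℕ) :
    w' (steinberg F (uni x * dia F n) (discVec F)) = ((resCard F : ℂ) ^ n)⁻¹ * w' (discVec F) := by
  have key {x : F} (hx : valuation F x ≤ 1) :
      w' (steinberg F (uni x * dia F n) (discVec F)) = w' (steinberg F (dia F n) (discVec F)) := by
    rw [map_mul, Module.End.mul_apply, hw _ (uni_mem_iwahori hx)]
  have h := congrArg w' (sum_steinberg_discVec (F := F) n)
  rw [map_sum, Finset.sum_congr rfl fun x hx => key (valuation_le_one_of_mem_reps hx),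
    Finset.sum_const, card_reps, nsmul_eq_mul, Nat.cast_pow] at h
  have hq : ((resCard F : ℂ) ^ n) ≠ 0 := by
    have := (one_lt_resCard F).ne_bot
    exact pow_ne_zero _ (by simpa using this)
  rw [key hx, ← h, inv_mul_cancel_left₀ hq]

lemma IsIwahoriFixed.dual_om {w' : StDual F} (hw : IsIwahoriFixed w') :
    IsIwahoriFixed ((steinberg F).dual (om F)⁻¹ w') := by
  intro k hk v
  rw [dual_steinberg_apply, dual_steinberg_apply, inv_inv, ← Module.End.mul_apply, ← map_mul,
    show om F * k = (om F * k * (om F)⁻¹) * om F by group, map_mul, Module.End.mul_apply,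
    hw.apply_of_mk_mem]
  have := omBar_conj_mem (F := F) (q := QuotientGroup.mk k) ⟨k, hk, rfl⟩
  nth_rw 2 [← omBar_inv] at this
  exact this

/-- The sign by which an element of `{1, om}` acts on the Iwahori fixed vector. -/
def boolSign (e : Bool) : ℂ := if e then -1 else 1

lemma coeff_cosetRep (w' : StDual F) (i : CosetIdx F) :
    coeff w' (discVec F) (cosetRep i) = boolSign i.1.1.2 *
      (if i.1.1.1 then (steinberg F).dual (om F)⁻¹ w' else w')
        (steinberg F (uni i.2.1 * dia F (i.1.2 + i.1.1.1.toNat)) (discVec F)) := by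
  obtain ⟨⟨⟨e, d⟩, n⟩, x, hx⟩ := i
  have h1 (u' : StDual F) (q : GL2ModCenter F) : coeff u' (discVec F) (q * omPow F d) =
      boolSign d * coeff u' (discVec F) q := by
    cases d
    · simp [omPow, boolSign]
    · simp only [omPow, boolSign, if_true, omBar]
      rw [coeff_mul_mk, steinberg_om_discVec, ← neg_one_smul ℂ (discVec F), coeff_smul_right]
      rfl
  rw [cosetRep, h1]
  congr 1
  cases e
  · simp only [omPow, Bool.false_eq_true, if_false, one_mul, pt]
    rw [coeff_mk]
  · simp only [omPow, if_true, omBar, pt]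
    rw [coeff_mk_mul, coeff_mk]

lemma IsIwahoriFixed.coeff_cosetRep {w' : StDual F} (hw : IsIwahoriFixed w') (i : CosetIdx F) :
    coeff w' (discVec F) (cosetRep i) = boolSign i.1.1.2 * (boolSign i.1.1.1 *
      (((resCard F : ℂ) ^ (i.1.2 + i.1.1.1.toNat))⁻¹ * w' (discVec F))) := by
  rw [GL2Steinberg.coeff_cosetRep]
  obtain ⟨⟨⟨e, d⟩, n⟩, x, hx⟩ := i
  congr 1
  have hx1 := valuation_le_one_of_mem_reps hx
  cases e
  · simp only [Bool.false_eq_true, if_false, boolSign, one_mul]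
    exact hw.apply_uni_mul_dia hx1 _
  · simp only [if_true, boolSign]
    rw [hw.dual_om.apply_uni_mul_dia hx1, dual_steinberg_apply, inv_inv, steinberg_om_discVec,
      map_neg]
    ring

/-- Iwahori fixed functionals are determined by their value at the Iwahori fixed vector. -/
lemma IsIwahoriFixed.eq_smul {w' u' : StDual F} (hw : IsIwahoriFixed w') (hu : IsIwahoriFixed u')
    (h1 : u' (discVec F) = 1) : w' = w' (discVec F) • u' := by
  have hq (q : GL2ModCenter F) : coeff w' (discVec F) q =
      w' (discVec F) * coeff u' (discVec F) q := by
    obtain ⟨i, hi⟩ := exists_cosetRep q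
    rw [← mul_inv_cancel_left (cosetRep i) q, coeff_discVec_mul _ _ hi, coeff_discVec_mul _ _ hi,
      hw.coeff_cosetRep, hu.coeff_cosetRep, h1]
    ring
  -- A functional is determined by its coefficient at the disc vector, because the translates of
  -- that vector span.
  refine LinearMap.ext_on_range span_steinberg_discVec fun g => ?_
  rw [← coeff_mk, hq, coeff_mk]; rfl

end IwahoriFixed

/-! ### Existence of a nonzero Iwahori-fixed functional. -/

section Functional

variable {F : Type*} [Field F] [ValuativeRel F] [TopologicalSpace F]
    [IsNonarchimedeanLocalField F]

/-- A function of `Ind_B^G 1` as a function on `G/Z`. -/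
def indBar (f : IndSpace F) (q : GL2ModCenter F) : ℂ := f.1 q.out

lemma indBar_mk (f : IndSpace F) (g : GL2 F) : indBar f (QuotientGroup.mk g) = f.1 g := by
  obtain ⟨z, hz⟩ := QuotientGroup.mk_out_eq_mul (Subgroup.center (GL2 F)) g
  rw [indBar, hz, indSpace_mul_center _ z.2]

lemma indBar_indRep (f : IndSpace F) (g : GL2 F) (q : GL2ModCenter F) :
    indBar (indRep F g f) q = indBar f (q * QuotientGroup.mk g) := by
  obtain ⟨x, rfl⟩ := QuotientGroup.mk_surjective q
  rw [← QuotientGroup.mk_mul, indBar_mk, indBar_mk, indRep_apply]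

lemma continuous_indBar (f : IndSpace F) : Continuous (indBar f) := by
  obtain ⟨U, hU, h⟩ := f.2.2
  have : Continuous fun g : GL2 F => indBar f (QuotientGroup.mk g) := by
    refine IsLocallyConstant.continuous ((IsLocallyConstant.iff_eventually_eq _).2 fun g => ?_)
    have hg : (fun x => g⁻¹ * x) ⁻¹' U ∈ nhds g :=
      (hU.preimage (continuous_const_mul g⁻¹)).mem_nhds (by simp [one_mem])
    filter_upwards [hg] with x hx
    have := h g _ hx
    rw [indBar_mk, indBar_mk, ← this, mul_inv_cancel_left]
  exact QuotientGroup.isOpenQuotientMap_mk.isQuotientMap.continuous_iff.2 this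

variable [MeasurableSpace (GL2ModCenter F)] [BorelSpace (GL2ModCenter F)]
    (μ : Measure (GL2ModCenter F)) [μ.IsHaarMeasure]

lemma integrableOn_indBar (f : IndSpace F) :
    IntegrableOn (fun q => indBar f (omBar F * q) - indBar f q) (iwahoriBar F) μ :=
  (((continuous_indBar f).comp (continuous_const_mul _)).sub
    (continuous_indBar f)).continuousOn.integrableOn_compact'
      isCompact_iwahoriBar isOpen_iwahoriBar.measurableSet

/-- The difference of the integrals over two opposite discs, on `Ind_B^G 1`. -/
def discIntegral : IndSpace F →ₗ[ℂ] ℂ where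
  toFun f := (μ.real (iwahoriBar F) : ℂ)⁻¹ *
    ∫ q in (iwahoriBar F : Set (GL2ModCenter F)), (indBar f (omBar F * q) - indBar f q) ∂μ
  map_add' f f' := by
    rw [← mul_add, ← integral_add (integrableOn_indBar μ f) (integrableOn_indBar μ f')]
    congr 2; funext q
    change (f.1 _ + f'.1 _) - (f.1 _ + f'.1 _) = (f.1 _ - f.1 _) + (f'.1 _ - f'.1 _)
    ring
  map_smul' c f := by
    rw [RingHom.id_apply, smul_eq_mul, mul_left_comm]
    congr 1
    rw [← integral_const_mul]
    congr 1; funext q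
    change c * f.1 _ - c * f.1 _ = c * (f.1 _ - f.1 _)
    ring

/-- An Iwahori fixed functional on the Steinberg representation. -/
def discFunctional : StDual F :=
  (constantFunctions F).liftQ (discIntegral μ) <| by
    rintro f ⟨c, hc⟩
    change _ * _ = (0 : ℂ)
    rw [integral_congr_ae (g := fun _ => 0), integral_zero, mul_zero]
    exact Filter.Eventually.of_forall fun q => by simp [indBar, hc]

lemma discFunctional_mkQ (f : IndSpace F) :
    discFunctional μ ((constantFunctions F).mkQ f) = (μ.real (iwahoriBar F) : ℂ)⁻¹ *
    ∫ q in (iwahoriBar F : Set (GL2ModCenter F)), (indBar f (omBar F * q) - indBar f q) ∂μ := rfl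

/-- An element of I acts by right translation of the variable, which preserves both the domain of
integration and, by unimodularity, the measure. -/
lemma isIwahoriFixed_discFunctional : IsIwahoriFixed (discFunctional μ) := by
  intro k hk v
  obtain ⟨f, rfl⟩ := (constantFunctions F).mkQ_surjective v
  rw [steinberg_mk, discFunctional_mkQ, discFunctional_mkQ]
  congr 1
  have hk' : (QuotientGroup.mk k : GL2ModCenter F) ∈ iwahoriBar F := ⟨k, hk, rfl⟩
  have hpre : (· * (QuotientGroup.mk k : GL2ModCenter F)) ⁻¹' (iwahoriBar F : Set _) =
      iwahoriBar F := by
    ext q; exact Subgroup.mul_mem_cancel_right _ hk'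
  have h := (measurePreserving_mul_right μ (QuotientGroup.mk k)).setIntegral_preimage_emb
    (MeasurableEquiv.mulRight (QuotientGroup.mk k : GL2ModCenter F)).measurableEmbedding
    (fun q => indBar f (omBar F * q) - indBar f q) (iwahoriBar F)
  rw [hpre] at h
  rw [← h]
  simp only [indBar_indRep, mul_assoc]

/-- For k in I the bottom row of k is outside the disc and that of ωk, being ϖ times the top row of
k, is inside; the integrand is constantly 1. -/
lemma discFunctional_discVec : discFunctional μ (discVec F) = 1 := by
  rw [discVec, discFunctional_mkQ, setIntegral_congr_fun (g := fun _ => (1 : ℂ))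
    isOpen_iwahoriBar.measurableSet]
  · rw [setIntegral_const]
    have : μ.real (iwahoriBar F) ≠ 0 :=
      (measureReal_ne_zero_iff (measure_iwahoriBar_ne_top μ)).2 (measure_iwahoriBar_ne_zero μ)
    rw [Complex.real_smul, mul_one, inv_mul_cancel₀ (by exact_mod_cast this)]
  · rintro q ⟨k, ⟨h1, h2, h3, h4⟩, rfl⟩
    change indBar (discInd F) (omBar F * QuotientGroup.mk k) -
      indBar (discInd F) (QuotientGroup.mk k) = 1
    rw [omBar, ← QuotientGroup.mk_mul, indBar_mk, indBar_mk]
    change discFun _ - discFun _ = 1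
    have e0 : (om F * k).1 1 0 = unif F * k.1 0 0 := by rw [mul_row]; simp [om]
    have e1 : (om F * k).1 1 1 = unif F * k.1 0 1 := by rw [mul_row]; simp [om]
    rw [discFun, discFun, if_pos, if_neg, sub_zero]
    · rw [not_le, h2]; exact h4
    · rw [e0, e1, map_mul, map_mul, h1]; gcongr

lemma discFunctional_mem_smoothDual : discFunctional μ ∈ smoothDual (steinberg F) := by
  refine ⟨iwahoriSubgroup F, isOpen_iwahoriSubgroup, fun k hk => ?_⟩
  refine LinearMap.ext fun v => ?_
  exact isIwahoriFixed_discFunctional μ _ (inv_mem hk) v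

end Functional

/-! ### Decay and square integrability of the coefficients. -/

section SquareIntegrable

variable {F : Type*} [Field F] [ValuativeRel F] [TopologicalSpace F]
    [IsNonarchimedeanLocalField F]

lemma resCard_pow_ne_zero (n : ℕ) : (resCard F : ℂ) ^ n ≠ 0 := by
  have := (one_lt_resCard F).ne_bot
  exact pow_ne_zero _ (by simpa using this)

lemma apply_uni_mul_dia_congr (w' : StDual F) {x y : F} {n : ℕ}
    (h : valuation F (x - y) ≤ valuation F (unif F) ^ n) :
    w' (steinberg F (uni y * dia F n) (discVec F)) =
      w' (steinberg F (uni x * dia F n) (discVec F)) := by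
  have h1 := (pt_inv_mul_pt_mem_iff (m := n) (n := n)).2 ⟨rfl, h⟩
  have h2 := coeff_discVec_mul w' (pt x n) h1
  rwa [mul_inv_cancel_left, pt, pt, coeff_mk, coeff_mk] at h2

lemma apply_uni_mul_dia_add {w' : StDual F} {N : ℕ}
    (hN : ∀ z, valuation F z ≤ valuation F (unif F) ^ N → ∀ v, w' (steinberg F (uni z) v) = w' v)
    (x : F) (m : ℕ) :
    w' (steinberg F (uni x * dia F (N + m)) (discVec F)) =
      ((resCard F : ℂ) ^ m)⁻¹ * w' (steinberg F (uni x * dia F N) (discVec F)) := by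
  have h := congrArg (fun v => w' (steinberg F (uni x * dia F N) v)) (sum_steinberg_discVec (F := F) m)
  simp only [map_sum] at h
  -- Subdividing a disc of level N by m further levels moves its centre x only by elements of 𝔭^N,
  -- to which the functional is insensitive; so all q^m terms agree.
  have key : ∀ y ∈ reps F m,
      w' (steinberg F (uni x * dia F N) (steinberg F (uni y * dia F m) (discVec F))) =
      w' (steinberg F (uni x * dia F (N + m)) (discVec F)) := by
    intro y hy
    rw [← Module.End.mul_apply, ← map_mul, show uni x * dia F N * (uni y * dia F m) =
      uni (unif F ^ N * y) * (uni x * dia F (N + m)) by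
        simp only [uni_mul_dia]
        simp only [uni, mat_mul_mat]
        congr 1 <;> simp [pow_add, add_comm], map_mul, Module.End.mul_apply, hN]
    rw [map_mul, map_pow]
    exact mul_le_of_le_one_right' (valuation_le_one_of_mem_reps hy)
  rw [Finset.sum_congr rfl key, Finset.sum_const, card_reps, nsmul_eq_mul, Nat.cast_pow] at h
  rw [← h, inv_mul_cancel_left₀ (resCard_pow_ne_zero m)]

/-- Exponential decay of the matrix coefficients of the Iwahori fixed vector. -/
lemma exists_norm_apply_uni_mul_dia_le {w' : StDual F} (hw : w' ∈ smoothDual (steinberg F)) :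
    ∃ C : ℝ, ∀ n x, valuation F x ≤ 1 →
      ‖w' (steinberg F (uni x * dia F n) (discVec F))‖ ≤ C * ((resCard F : ℝ) ^ n)⁻¹ := by
  obtain ⟨U, hU, h⟩ := hw
  obtain ⟨N, hN⟩ := exists_uni_mem_of_isOpen hU
  have hfix (z) (hz : valuation F z ≤ valuation F (unif F) ^ N) (v) :
      w' (steinberg F (uni z) v) = w' v := by
    have := congrArg (fun u : StDual F => u v) (h _ (inv_mem (hN z hz)))
    simpa only [dual_steinberg_apply, inv_inv] using this
  have hq (n : ℕ) : (0 : ℝ) < (resCard F : ℝ) ^ n :=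
    pow_pos (by exact_mod_cast (one_lt_resCard F).pos) _
  let D (n : ℕ) : ℝ := ∑ x ∈ reps F n, ‖w' (steinberg F (uni x * dia F n) (discVec F))‖
  have hD (n : ℕ) (x : F) (hx : valuation F x ≤ 1) :
      ‖w' (steinberg F (uni x * dia F n) (discVec F))‖ ≤ D n := by
    obtain ⟨y, ⟨hy, hxy⟩, -⟩ := existsUnique_mem_reps n hx
    rw [← apply_uni_mul_dia_congr w' hxy]
    exact Finset.single_le_sum (f := fun x => ‖w' (steinberg F (uni x * dia F n) (discVec F))‖)
      (fun _ _ => norm_nonneg _) hy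
  have hD0 (n : ℕ) : 0 ≤ D n := Finset.sum_nonneg fun _ _ => norm_nonneg _
  -- The finitely many levels up to N are bounded crudely by a sum; beyond N the decay is exact.
  let C : ℝ := ∑ n ∈ Finset.range (N + 1), D n * (resCard F : ℝ) ^ n
  have hC (n : ℕ) (hn : n ≤ N) : D n ≤ C * ((resCard F : ℝ) ^ n)⁻¹ := by
    rw [le_mul_inv_iff₀ (hq n)]
    exact Finset.single_le_sum (f := fun n => D n * (resCard F : ℝ) ^ n)
      (fun n _ => mul_nonneg (hD0 n) (hq n).le) (Finset.mem_range.2 (by lia))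
  refine ⟨C, fun n x hx => ?_⟩
  rcases le_total n N with hn | hn
  · exact (hD n x hx).trans (hC n hn)
  · obtain ⟨m, rfl⟩ := Nat.exists_eq_add_of_le hn
    rw [apply_uni_mul_dia_add hfix, norm_mul, norm_inv, norm_pow, Complex.norm_natCast]
    have := (hD N x hx).trans (hC N le_rfl)
    calc _ ≤ ((resCard F : ℝ) ^ m)⁻¹ * (C * ((resCard F : ℝ) ^ N)⁻¹) := by
          have := inv_pos.2 (hq m); gcongr
      _ = _ := by rw [pow_add, mul_inv]; ring

variable (F) in
-- The number of classes x at a given level cancels one of the two factors of the square. A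
-- geometric series remains, with 1 + 1/q from the left exponent of ω and 2 from the right one.
lemma tsum_cosetIdx : ∑' i : CosetIdx F, (((resCard F : ENNReal)⁻¹) ^ (i.1.2 + i.1.1.1.toNat)) ^ 2 =
    2 * (1 + (resCard F : ENNReal)⁻¹) * (1 - (resCard F : ENNReal)⁻¹)⁻¹ := by
  set r : ENNReal := (resCard F : ENNReal)⁻¹ with hr
  have hq0 : (resCard F : ENNReal) ≠ 0 := by
    exact_mod_cast (one_lt_resCard F).ne_bot
  have h1 (p : (Bool × Bool) × ℕ) :
      ∑' _ : reps F (p.2 + p.1.1.toNat), (r ^ (p.2 + p.1.1.toNat)) ^ 2 = r ^ (p.2 + p.1.1.toNat) := by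
    rw [tsum_fintype, Finset.sum_const, Finset.card_univ, Fintype.card_coe, card_reps, nsmul_eq_mul,
      sq, ← mul_assoc, Nat.cast_pow, hr, ← mul_pow, ENNReal.mul_inv_cancel hq0 (by simp), one_pow,
      one_mul]
  rw [ENNReal.tsum_sigma' (f := fun i : CosetIdx F => (r ^ (i.1.2 + i.1.1.1.toNat)) ^ 2)]
  simp only [h1]
  rw [ENNReal.tsum_prod', tsum_fintype, Fintype.sum_prod_type]
  simp only [Fintype.sum_bool, Bool.toNat_true, Bool.toNat_false, add_zero, pow_succ,
    ENNReal.tsum_mul_right, ENNReal.tsum_geometric]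
  ring

lemma tsum_cosetIdx_lt_top :
    2 * (1 + (resCard F : ENNReal)⁻¹) * (1 - (resCard F : ENNReal)⁻¹)⁻¹ < ⊤ := by
  have h1 : (resCard F : ENNReal)⁻¹ < 1 := by
    rw [ENNReal.inv_lt_one]; exact_mod_cast one_lt_resCard F
  refine ENNReal.mul_lt_top (ENNReal.mul_lt_top (by simp) ?_) ?_
  · exact ENNReal.add_lt_top.2 ⟨by simp, h1.trans (by simp)⟩
  · rw [ENNReal.inv_lt_top]; exact tsub_pos_of_lt h1

variable [MeasurableSpace (GL2ModCenter F)] [BorelSpace (GL2ModCenter F)]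
    (μ : Measure (GL2ModCenter F)) [μ.IsHaarMeasure]

lemma memLp_coeff_discVec {w' : StDual F} (hw : w' ∈ smoothDual (steinberg F)) :
    MemLp (coeff w' (discVec F)) 2 μ := by
  refine ⟨(continuous_coeff _ _).aestronglyMeasurable, ?_⟩
  rw [eLpNorm_lt_top_iff_lintegral_rpow_enorm_lt_top two_ne_zero ENNReal.ofNat_ne_top]
  have h2 (x : ENNReal) : x ^ (2 : ENNReal).toReal = x ^ 2 := by
    rw [ENNReal.toReal_ofNat]; exact_mod_cast ENNReal.rpow_natCast x 2
  simp only [h2]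
  rw [lintegral_eq_tsum_cosetRep μ _ fun q k hk => by rw [coeff_discVec_mul _ _ hk]]
  refine ENNReal.mul_lt_top (measure_iwahoriBar_ne_top μ).lt_top ?_
  obtain ⟨C, hC⟩ := exists_norm_apply_uni_mul_dia_le hw
  -- On the cosets with ω on the left the coefficient is one of the functional translated by ω,
  -- which needs its own bound.
  obtain ⟨C', hC'⟩ := exists_norm_apply_uni_mul_dia_le (dual_mem_smoothDual hw (om F)⁻¹)
  let B := ENNReal.ofReal (max C C')
  have hb (i : CosetIdx F) : ‖coeff w' (discVec F) (cosetRep i)‖ₑ ^ 2 ≤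
      B ^ 2 * (((resCard F : ENNReal)⁻¹) ^ (i.1.2 + i.1.1.1.toNat)) ^ 2 := by
    rw [← mul_pow]
    gcongr
    have hq : (0 : ℝ) < resCard F := by exact_mod_cast (one_lt_resCard F).pos
    have e : B * ((resCard F : ENNReal)⁻¹) ^ (i.1.2 + i.1.1.1.toNat) =
        ENNReal.ofReal (max C C' * ((resCard F : ℝ) ^ (i.1.2 + i.1.1.1.toNat))⁻¹) := by
      rw [ENNReal.ofReal_mul' (by positivity), ENNReal.ofReal_inv_of_pos (by positivity),
        ENNReal.ofReal_pow hq.le, ENNReal.ofReal_natCast, ENNReal.inv_pow]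
    rw [e, ← ofReal_norm]
    refine ENNReal.ofReal_le_ofReal ?_
    have hs (d : Bool) : ‖boolSign d‖ = 1 := by cases d <;> simp [boolSign]
    rw [coeff_cosetRep, norm_mul, hs, one_mul]
    have hx := valuation_le_one_of_mem_reps i.2.2
    split_ifs with he
    · exact (hC' _ _ hx).trans (by gcongr; exact le_max_right _ _)
    · exact (hC _ _ hx).trans (by gcongr; exact le_max_left _ _)
  refine (ENNReal.tsum_le_tsum hb).trans_lt ?_
  rw [ENNReal.tsum_mul_left, tsum_cosetIdx]
  exact ENNReal.mul_lt_top (by simp [B]) tsum_cosetIdx_lt_top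

/-- The matrix coefficients of the Steinberg representation are square integrable. -/
lemma memLp_coeff {w' : StDual F} (hw : w' ∈ smoothDual (steinberg F)) (v : StSpace F) :
    MemLp (coeff w' v) 2 μ := by
  have hv : v ∈ Submodule.span ℂ (Set.range fun g => steinberg F g (discVec F)) := by
    rw [span_steinberg_discVec]; trivial
  induction hv using Submodule.span_induction with
  | mem x hx =>
    obtain ⟨g, rfl⟩ := hx
    have : coeff w' (steinberg F g (discVec F)) =
        coeff w' (discVec F) ∘ fun q => q * QuotientGroup.mk g := by
      funext q; exact (coeff_mul_mk _ _ _ _).symm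
    rw [this]
    exact (memLp_coeff_discVec μ hw).comp_measurePreserving (measurePreserving_mul_right μ _)
  | zero =>
    have : coeff w' (0 : StSpace F) = 0 := by funext q; simp [coeff]
    rw [this]; exact MemLp.zero
  | add x y _ _ hx hy => rw [coeff_add_right]; exact hx.add hy
  | smul c x _ hx => rw [coeff_smul_right]; exact hx.const_smul c

lemma isSquareIntegrable_steinberg : IsSquareIntegrableModCenter (steinberg F) μ := by
  intro w' hw v
  refine ⟨fun q => ‖coeff w' v q‖ ^ 2, fun g => congrArg (‖·‖ ^ 2) (coeff_mk w' v g), ?_⟩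
  exact (memLp_two_iff_integrable_sq_norm (continuous_coeff _ _).aestronglyMeasurable).1
    (memLp_coeff μ hw v)

end SquareIntegrable

/-! ### Schur orthogonality by Iwahori averaging. -/

section Schur

variable {F : Type*} [Field F] [ValuativeRel F] [TopologicalSpace F]
    [IsNonarchimedeanLocalField F]

/-- Averaging a smooth functional over the Iwahori subgroup. -/
lemma exists_average {w' : StDual F} (hw : w' ∈ smoothDual (steinberg F)) :
    ∃ (U : Subgroup (GL2 F)) (_ : Fintype (iwahoriSubgroup F ⧸ U.subgroupOf (iwahoriSubgroup F))),
      IsIwahoriFixed (∑ i : iwahoriSubgroup F ⧸ U.subgroupOf (iwahoriSubgroup F),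
        (steinberg F).dual (i.out : GL2 F) w') := by
  obtain ⟨U, hU, h⟩ := hw
  have := finite_quotient_iwahoriSubgroup hU
  let := Fintype.ofFinite (iwahoriSubgroup F ⧸ U.subgroupOf (iwahoriSubgroup F))
  refine ⟨U, this, ?_⟩
  intro k hk v
  let κ : iwahoriSubgroup F := ⟨k, hk⟩
  have hmk (j : iwahoriSubgroup F) :
      (steinberg F).dual ((QuotientGroup.mk j :
        iwahoriSubgroup F ⧸ U.subgroupOf (iwahoriSubgroup F)).out : GL2 F) w' =
        (steinberg F).dual (j : GL2 F) w' := by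
    obtain ⟨u, hu⟩ := QuotientGroup.mk_out_eq_mul (U.subgroupOf (iwahoriSubgroup F)) j
    rw [hu, Subgroup.coe_mul, map_mul, Module.End.mul_apply, h _ (Subgroup.mem_subgroupOf.1 u.2)]
  simp only [LinearMap.sum_apply]
  -- Evaluating at the translate by k amounts to left translation by k⁻¹ of the cosets summed over.
  refine Fintype.sum_equiv (MulAction.toPerm κ⁻¹) _ _ fun i => ?_
  have hi : (MulAction.toPerm κ⁻¹ : Equiv.Perm _) i =
      (QuotientGroup.mk (κ⁻¹ * i.out) :
        iwahoriSubgroup F ⧸ U.subgroupOf (iwahoriSubgroup F)) := by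
    conv_lhs => rw [← QuotientGroup.out_eq' i]
    rfl
  rw [hi, hmk, dual_steinberg_apply, dual_steinberg_apply, ← Module.End.mul_apply, ← map_mul,
    Subgroup.coe_mul, Subgroup.coe_inv, mul_inv_rev, inv_inv]

/-- An invariant pairing of the smooth dual with the Steinberg representation is a multiple of the
canonical pairing. -/
lemma pairing_eq {ℓ : StDual F} (hℓ : ℓ ∈ smoothDual (steinberg F)) (hI : IsIwahoriFixed ℓ)
    (h1 : ℓ (discVec F) = 1) (β : smoothDual (steinberg F) →ₗ[ℂ] StSpace F →ₗ[ℂ] ℂ)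
    (hβ : ∀ (w' : smoothDual (steinberg F)) (v : StSpace F) (g : GL2 F),
      β ⟨(steinberg F).dual g w', dual_mem_smoothDual w'.2 g⟩ (steinberg F g v) = β w' v)
    (w' : smoothDual (steinberg F)) (v : StSpace F) :
    β w' v = β ⟨ℓ, hℓ⟩ (discVec F) * w'.1 v := by
  have base (w' : smoothDual (steinberg F)) :
      β w' (discVec F) = β ⟨ℓ, hℓ⟩ (discVec F) * w'.1 (discVec F) := by
    obtain ⟨U, hfin, hk⟩ := exists_average w'.2
    let ι := iwahoriSubgroup F ⧸ U.subgroupOf (iwahoriSubgroup F)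
    let k (i : ι) : iwahoriSubgroup F := i.out
    let : Fintype ι := hfin
    change IsIwahoriFixed (∑ i : ι, (steinberg F).dual (k i : GL2 F) w'.1) at hk
    have : Nonempty ι := ⟨(QuotientGroup.mk 1 : iwahoriSubgroup F ⧸ _)⟩
    have hcard : (Fintype.card ι : ℂ) ≠ 0 := by exact_mod_cast Fintype.card_ne_zero
    have e1 (i : ι) : steinberg F (k i : GL2 F)⁻¹ (discVec F) = discVec F :=
      steinberg_iwahori_discVec (inv_mem (k i).2)
    have hval : (∑ i, (steinberg F).dual (k i : GL2 F) w'.1) (discVec F) =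
        Fintype.card ι * w'.1 (discVec F) := by
      simp only [LinearMap.sum_apply, dual_steinberg_apply, e1, Finset.sum_const,
        Finset.card_univ, nsmul_eq_mul]
    have hsum : ∑ i, (⟨(steinberg F).dual (k i : GL2 F) w', dual_mem_smoothDual w'.2 _⟩ :
        smoothDual (steinberg F)) = ((Fintype.card ι : ℂ) * w'.1 (discVec F)) • ⟨ℓ, hℓ⟩ := by
      apply Subtype.ext
      rw [AddSubmonoidClass.coe_finsetSum]
      exact (hk.eq_smul hI h1).trans (by rw [hval]; rfl)
    have h2 := congrArg (fun u => β u (discVec F)) hsum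
    simp only [map_sum, LinearMap.sum_apply, map_smul, LinearMap.smul_apply, smul_eq_mul] at h2
    -- The disc vector is fixed by I, so invariance of β makes averaging the functional harmless.
    have h3 (i : ι) : β ⟨(steinberg F).dual (k i : GL2 F) w', dual_mem_smoothDual w'.2 _⟩
        (discVec F) = β w' (discVec F) := by
      rw [← hβ w' (discVec F) (k i), steinberg_iwahori_discVec (k i).2]
    simp only [h3, Finset.sum_const, Finset.card_univ, nsmul_eq_mul] at h2
    refine mul_left_cancel₀ hcard (h2.trans ?_)
    ring
  -- By invariance, a translate of the disc vector is traded for a translate of the functional, and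
  -- the translates span.
  have h0 : β w' = β ⟨ℓ, hℓ⟩ (discVec F) • w'.1 := by
    refine LinearMap.ext_on_range span_steinberg_discVec fun g => ?_
    have h3 : (⟨(steinberg F).dual g ((steinberg F).dual g⁻¹ w'.1),
        dual_mem_smoothDual (dual_mem_smoothDual w'.2 _) _⟩ : smoothDual (steinberg F)) = w' := by
      apply Subtype.ext
      change (steinberg F).dual g ((steinberg F).dual g⁻¹ w'.1) = w'.1
      rw [← Module.End.mul_apply, ← map_mul, mul_inv_cancel, map_one, Module.End.one_apply]
    have h2 : β w' (steinberg F g (discVec F)) = _ :=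
      (congrArg (fun u => β u (steinberg F g (discVec F))) h3).symm.trans
        ((hβ ⟨(steinberg F).dual g⁻¹ w', dual_mem_smoothDual w'.2 _⟩ (discVec F) g).trans (base _))
    refine h2.trans ?_
    change β ⟨ℓ, hℓ⟩ (discVec F) * w'.1 (steinberg F g⁻¹⁻¹ (discVec F)) =
      β ⟨ℓ, hℓ⟩ (discVec F) * w'.1 (steinberg F g (discVec F))
    rw [inv_inv]
  exact LinearMap.congr_fun h0 v

variable [MeasurableSpace (GL2ModCenter F)] [BorelSpace (GL2ModCenter F)]
    (μ : Measure (GL2ModCenter F)) [μ.IsHaarMeasure]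

lemma integrable_coeff_mul {v' w' : StDual F} (hv : v' ∈ smoothDual (steinberg F))
    (hw : w' ∈ smoothDual (steinberg F)) (v w : StSpace F) :
    Integrable (fun q => coeff v' v q⁻¹ * coeff w' w q) μ :=
  ((memLp_coeff μ hv v).comp_measurePreserving (Measure.measurePreserving_inv μ)).integrable_mul
    (memLp_coeff μ hw w)

/-- The integral in Schur's orthogonality relation. -/
def schurIntegral (v' w' : StDual F) (v w : StSpace F) : ℂ :=
  ∫ q, coeff v' v q⁻¹ * coeff w' w q ∂μ

lemma schurIntegral_swap (v' w' : StDual F) (v w : StSpace F) :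
    schurIntegral μ v' w' v w = schurIntegral μ w' v' w v := by
  rw [schurIntegral, ← integral_inv_eq_self, schurIntegral]
  congr 1; funext q
  rw [inv_inv, mul_comm]

lemma schurIntegral_invariant (v' w' : StDual F) (v w : StSpace F) (g : GL2 F) :
    schurIntegral μ ((steinberg F).dual g v') w' v (steinberg F g w) =
      schurIntegral μ v' w' v w := by
  refine Eq.trans ?_ (integral_mul_right_eq_self (fun q => coeff v' v q⁻¹ * coeff w' w q)
    (QuotientGroup.mk g))
  rw [schurIntegral]
  congr 1; funext q
  rw [coeff_mul_mk, mul_inv_rev, ← QuotientGroup.mk_inv, coeff_mk_mul, inv_inv]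

/-- The Schur integral as an invariant pairing. -/
def schurPairing {w' : StDual F} (hw : w' ∈ smoothDual (steinberg F)) (v : StSpace F) :
    smoothDual (steinberg F) →ₗ[ℂ] StSpace F →ₗ[ℂ] ℂ :=
  LinearMap.mk₂ ℂ (fun v' w => schurIntegral μ v'.1 w' v w)
    (fun v' u' w => by
      simp only [schurIntegral]
      rw [← integral_add (integrable_coeff_mul μ v'.2 hw v w) (integrable_coeff_mul μ u'.2 hw v w)]
      congr 1; funext q
      rw [Submodule.coe_add, coeff_add_left, Pi.add_apply, add_mul])
    (fun c v' w => by
      simp only [schurIntegral, smul_eq_mul]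
      rw [← integral_const_mul]
      congr 1; funext q
      rw [Submodule.coe_smul, coeff_smul_left, Pi.smul_apply, smul_eq_mul, mul_assoc])
    (fun v' w u => by
      simp only [schurIntegral]
      rw [← integral_add (integrable_coeff_mul μ v'.2 hw v w) (integrable_coeff_mul μ v'.2 hw v u)]
      congr 1; funext q
      rw [coeff_add_right, Pi.add_apply, mul_add])
    (fun c v' w => by
      simp only [schurIntegral, smul_eq_mul]
      rw [← integral_const_mul]
      congr 1; funext q
      rw [coeff_smul_right, Pi.smul_apply, smul_eq_mul, mul_left_comm])

/-- For fixed w' and v the integral is an invariant pairing of v' with w. Inversion exchanges the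
two coefficients, so the same argument applies to w' and v. -/
lemma schurIntegral_eq {v' w' : StDual F} (hv : v' ∈ smoothDual (steinberg F))
    (hw : w' ∈ smoothDual (steinberg F)) (v w : StSpace F) :
    schurIntegral μ v' w' v w =
      schurIntegral μ (discFunctional μ) (discFunctional μ) (discVec F) (discVec F) *
        (v' w * w' v) := by
  have key {v' w' : StDual F} (hv : v' ∈ smoothDual (steinberg F))
      (hw : w' ∈ smoothDual (steinberg F)) (v w : StSpace F) :
      schurIntegral μ v' w' v w = schurIntegral μ (discFunctional μ) w' v (discVec F) * v' w :=
    pairing_eq (discFunctional_mem_smoothDual μ) (isIwahoriFixed_discFunctional μ)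
      (discFunctional_discVec μ) (schurPairing μ hw v)
      (fun u' u g => schurIntegral_invariant μ u'.1 w' v u g) ⟨v', hv⟩ w
  rw [key hv hw, schurIntegral_swap, key hw (discFunctional_mem_smoothDual μ)]
  ring

end Schur

/-! ### The L² norm of the basic coefficient and the formal dimension. -/

section Value

variable {F : Type*} [Field F] [ValuativeRel F] [TopologicalSpace F]
    [IsNonarchimedeanLocalField F]

lemma coeff_discVec_mul_omBar (w' : StDual F) (q : GL2ModCenter F) :
    coeff w' (discVec F) (q * omBar F) = -coeff w' (discVec F) q := by
  rw [omBar, coeff_mul_mk, steinberg_om_discVec, ← neg_one_smul ℂ (discVec F), coeff_smul_right]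
  simp

lemma IsIwahoriFixed.coeff_mul_left {w' : StDual F} (hw : IsIwahoriFixed w') (v : StSpace F)
    {k : GL2ModCenter F} (hk : k ∈ iwahoriBar F) (q : GL2ModCenter F) :
    coeff w' v (k * q) = coeff w' v q := by
  obtain ⟨g, rfl⟩ := QuotientGroup.mk_surjective q
  obtain ⟨k, hk, rfl⟩ := hk
  rw [QuotientGroup.mk'_apply, ← QuotientGroup.mk_mul, coeff_mk, coeff_mk, map_mul,
    Module.End.mul_apply, hw k hk]

/-- The translate of ℓ by ω is again I-fixed, so by uniqueness it is a multiple of ℓ; its value at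
the disc vector is -1. -/
lemma IsIwahoriFixed.dual_om_eq_neg {ℓ : StDual F} (hI : IsIwahoriFixed ℓ)
    (h1 : ℓ (discVec F) = 1) : (steinberg F).dual (om F)⁻¹ ℓ = -ℓ := by
  rw [hI.dual_om.eq_smul hI h1, dual_steinberg_apply, inv_inv, steinberg_om_discVec, map_neg, h1,
    neg_one_smul]

lemma IsIwahoriFixed.coeff_omBar_mul {ℓ : StDual F} (hI : IsIwahoriFixed ℓ)
    (h1 : ℓ (discVec F) = 1) (v : StSpace F) (q : GL2ModCenter F) :
    coeff ℓ v (omBar F * q) = -coeff ℓ v q := by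
  rw [omBar, coeff_mk_mul, hI.dual_om_eq_neg h1]
  rfl

lemma mk_dia_inv (n : ℕ) : (QuotientGroup.mk (dia F n) : GL2ModCenter F)⁻¹ =
    omBar F * QuotientGroup.mk (dia F n) * omBar F := by
  rw [inv_eq_iff_mul_eq_one, omBar, ← QuotientGroup.mk_mul, ← QuotientGroup.mk_mul,
    ← QuotientGroup.mk_mul, QuotientGroup.eq_one_iff]
  refine mem_center_of_eq_scalar (c := unif F ^ (n + 1)) ?_
  simp only [dia, om, mat_mul_mat, val_mat]
  ext i j; fin_cases i <;> fin_cases j <;> simp [pow_succ, mul_comm]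

lemma IsIwahoriFixed.coeff_pt_inv {ℓ : StDual F} (hI : IsIwahoriFixed ℓ)
    (h1 : ℓ (discVec F) = 1) {x : F} (hx : valuation F x ≤ 1) (n : ℕ) :
    coeff ℓ (discVec F) (pt x n)⁻¹ = coeff ℓ (discVec F) (pt x n) := by
  have hu : (QuotientGroup.mk (uni x) : GL2ModCenter F) ∈ iwahoriBar F :=
    ⟨_, uni_mem_iwahori hx, rfl⟩
  rw [pt, QuotientGroup.mk_mul, mul_inv_rev, coeff_discVec_mul _ _ (inv_mem hu), mk_dia_inv,
    coeff_discVec_mul_omBar, hI.coeff_omBar_mul h1, neg_neg, hI.coeff_mul_left _ hu]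

/-- Modulo the centre the inverse of diag(ϖ^n, 1) is its conjugate by ω, and the two signs cancel.
With `coeff_mul_self` this turns the Schur integrand into the square of an absolute value. -/
lemma IsIwahoriFixed.coeff_inv {ℓ : StDual F} (hI : IsIwahoriFixed ℓ)
    (h1 : ℓ (discVec F) = 1) (q : GL2ModCenter F) :
    coeff ℓ (discVec F) q⁻¹ = coeff ℓ (discVec F) q := by
  obtain ⟨i, hi⟩ := exists_cosetRep q
  have hx := valuation_le_one_of_mem_reps i.2.2
  have hl (e : Bool) (q) : coeff ℓ (discVec F) (omPow F e * q) =
      boolSign e * coeff ℓ (discVec F) q := by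
    cases e <;> simp [omPow, boolSign, hI.coeff_omBar_mul h1]
  have hr (e : Bool) (q) : coeff ℓ (discVec F) (q * omPow F e) =
      boolSign e * coeff ℓ (discVec F) q := by
    cases e <;> simp [omPow, boolSign, coeff_discVec_mul_omBar]
  have hinv (e : Bool) : (omPow F e)⁻¹ = omPow F e := by
    cases e <;> simp [omPow, omBar_inv]
  rw [← mul_inv_cancel_left (cosetRep i) q, coeff_discVec_mul _ _ hi, mul_inv_rev,
    hI.coeff_mul_left _ (inv_mem hi), cosetRep, mul_inv_rev, mul_inv_rev, hinv, hinv, hl, hr, hr, hl,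
    hI.coeff_pt_inv h1 hx]

lemma IsIwahoriFixed.enorm_coeff_cosetRep {ℓ : StDual F} (hI : IsIwahoriFixed ℓ)
    (h1 : ℓ (discVec F) = 1) (i : CosetIdx F) :
    ‖coeff ℓ (discVec F) (cosetRep i)‖ₑ =
      ((resCard F : ENNReal)⁻¹) ^ (i.1.2 + i.1.1.1.toNat) := by
  have hq : (0 : ℝ) < resCard F := by exact_mod_cast (one_lt_resCard F).pos
  have hs (d : Bool) : ‖boolSign d‖ = 1 := by cases d <;> simp [boolSign]
  rw [hI.coeff_cosetRep, ← ofReal_norm, norm_mul, norm_mul, norm_mul, hs, hs, h1, norm_one,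
    norm_inv, norm_pow, Complex.norm_natCast, one_mul, one_mul, mul_one,
    ENNReal.ofReal_inv_of_pos (by positivity),
    ENNReal.ofReal_pow hq.le, ENNReal.ofReal_natCast, ENNReal.inv_pow]

lemma IsIwahoriFixed.coeff_mul_self {ℓ : StDual F} (hI : IsIwahoriFixed ℓ)
    (h1 : ℓ (discVec F) = 1) (q : GL2ModCenter F) :
    coeff ℓ (discVec F) q * coeff ℓ (discVec F) q = ((‖coeff ℓ (discVec F) q‖ ^ 2 : ℝ) : ℂ) := by
  obtain ⟨i, hi⟩ := exists_cosetRep q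
  have hs (d : Bool) : boolSign d = ((if d then -1 else 1 : ℝ) : ℂ) := by
    cases d <;> simp [boolSign]
  obtain ⟨r, hr⟩ : ∃ r : ℝ, coeff ℓ (discVec F) q = r := by
    rw [← mul_inv_cancel_left (cosetRep i) q, coeff_discVec_mul _ _ hi, hI.coeff_cosetRep, h1, hs,
      hs]
    exact ⟨_ * (_ * (((resCard F : ℝ) ^ (i.1.2 + i.1.1.1.toNat))⁻¹ * 1)), by push_cast; rfl⟩
  rw [hr, Complex.norm_real, Real.norm_eq_abs, sq_abs]
  push_cast; ring

variable [MeasurableSpace (GL2ModCenter F)] [BorelSpace (GL2ModCenter F)]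
    (μ : Measure (GL2ModCenter F)) [μ.IsHaarMeasure]

/-- The constant in Schur's orthogonality relation. -/
lemma schurIntegral_discFunctional :
    schurIntegral μ (discFunctional μ) (discFunctional μ) (discVec F) (discVec F) =
      ((μ.real (iwahoriBar F) * (2 * (resCard F + 1) / (resCard F - 1)) : ℝ) : ℂ) := by
  have hI := isIwahoriFixed_discFunctional μ
  have h1 := discFunctional_discVec μ
  set c := coeff (discFunctional μ) (discVec F) with hc
  have hint : Integrable (fun q => ‖c q‖ ^ 2) μ :=
    (memLp_two_iff_integrable_sq_norm (continuous_coeff _ _).aestronglyMeasurable).1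
      (memLp_coeff μ (discFunctional_mem_smoothDual μ) _)
  have e1 : schurIntegral μ (discFunctional μ) (discFunctional μ) (discVec F) (discVec F) =
      ∫ q, ((‖c q‖ ^ 2 : ℝ) : ℂ) ∂μ := by
    rw [schurIntegral]
    congr 1; funext q
    rw [hI.coeff_inv h1, hI.coeff_mul_self h1]
  rw [e1, integral_complex_ofReal]
  congr 1
  rw [integral_eq_lintegral_of_nonneg_ae (Filter.Eventually.of_forall fun q => by positivity)
    hint.aestronglyMeasurable]
  have e2 (q) : ENNReal.ofReal (‖c q‖ ^ 2) = ‖c q‖ₑ ^ 2 := by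
    rw [ENNReal.ofReal_pow (norm_nonneg _), ofReal_norm]
  simp only [e2]
  rw [lintegral_eq_tsum_cosetRep μ _ fun q k hk => by rw [hc, coeff_discVec_mul _ _ hk]]
  simp only [hc, hI.enorm_coeff_cosetRep h1]
  rw [tsum_cosetIdx, ENNReal.toReal_mul]
  congr 1
  have hq : (1 : ℝ) < resCard F := by exact_mod_cast one_lt_resCard F
  have hq1 : (resCard F : ENNReal)⁻¹ ≤ 1 := by
    rw [ENNReal.inv_le_one]; exact_mod_cast (one_lt_resCard F).le
  rw [ENNReal.toReal_mul, ENNReal.toReal_mul, ENNReal.toReal_inv,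
    ENNReal.toReal_sub_of_le hq1 ENNReal.one_ne_top, ENNReal.toReal_add ENNReal.one_ne_top
      (hq1.trans_lt ENNReal.one_lt_top).ne, ENNReal.toReal_inv, ENNReal.toReal_natCast,
    ENNReal.toReal_one, ENNReal.toReal_ofNat]
  have h3 : (resCard F : ℝ) - 1 ≠ 0 := by linarith
  field_simp

/-- The formal dimension of the Steinberg representation in terms of the volume of the Iwahori
subgroup. -/
lemma isFormalDimension_steinberg_iff (d : ℝ) :
    IsFormalDimension (steinberg F) μ d ↔
      d = (μ.real (iwahoriBar F) * (2 * (resCard F + 1) / (resCard F - 1)))⁻¹ := by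
  set D : ℝ := μ.real (iwahoriBar F) * (2 * (resCard F + 1) / (resCard F - 1)) with hD
  have hq : (1 : ℝ) < resCard F := by exact_mod_cast one_lt_resCard F
  have hμ : 0 < μ.real (iwahoriBar F) :=
    ENNReal.toReal_pos (measure_iwahoriBar_ne_zero μ) (measure_iwahoriBar_ne_top μ)
  have hD0 : 0 < D := by
    have : (0 : ℝ) < resCard F - 1 := by linarith
    positivity
  have hcoeff (v' w' : StDual F) (v w : StSpace F) (g : GL2 F) :
      coeff v' v (QuotientGroup.mk g)⁻¹ * coeff w' w (QuotientGroup.mk g) =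
        (steinberg F).dual g v' v * w' (steinberg F g w) := by
    rw [← QuotientGroup.mk_inv, coeff_mk, coeff_mk, dual_steinberg_apply]
  constructor
  · intro h
    -- Uniqueness: testing on the normalized functional and the disc vector, where the right-hand
    -- side is d⁻¹, determines d.
    have hm := discFunctional_mem_smoothDual μ
    obtain ⟨Φ, hΦ, -, hint⟩ := h.schur _ hm _ hm (discVec F) (discVec F)
    have e : Φ = fun q => coeff (discFunctional μ) (discVec F) q⁻¹ *
        coeff (discFunctional μ) (discVec F) q := by
      funext q
      obtain ⟨g, rfl⟩ := QuotientGroup.mk_surjective q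
      exact (hΦ g).trans (hcoeff _ _ _ _ g).symm
    rw [e] at hint
    have h2 := (schurIntegral_discFunctional μ).symm.trans hint
    rw [discFunctional_discVec, mul_one, mul_one, ← hD, ← Complex.ofReal_inv,
      Complex.ofReal_inj] at h2
    rw [h2, inv_inv]
  · rintro rfl
    refine ⟨inv_pos.2 hD0, isSquareIntegrable_steinberg μ, fun v' hv w' hw v w => ?_⟩
    refine ⟨fun q => coeff v' v q⁻¹ * coeff w' w q, hcoeff v' w' v w,
      integrable_coeff_mul μ hv hw v w, ?_⟩
    refine (schurIntegral_eq μ hv hw v w).trans ?_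
    rw [schurIntegral_discFunctional, ← hD, Complex.ofReal_inv, inv_inv]

end Value

/-! ### The volume of the maximal compact subgroup. -/

section MaximalCompact

variable {F : Type*} [Field F] [ValuativeRel F] [TopologicalSpace F]
    [IsNonarchimedeanLocalField F]

lemma mk_uni_mul_dia_one_mul_om (x : F) : (pt x 1 * omBar F : GL2ModCenter F) =
    QuotientGroup.mk (mat x 1 1 0 (by simp)) := by
  rw [pt, omBar, ← QuotientGroup.mk_mul, QuotientGroup.eq, uni_mul_dia, om, mat_mul_mat, mat_inv,
    mat_mul_mat]
  have := unif_ne_zero F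
  refine mem_center_of_eq_scalar (c := (unif F)⁻¹) ?_
  rw [val_mat]
  ext i j; fin_cases i <;> fin_cases j <;> simp
  field_simp
  ring

/-- This is the Bruhat decomposition over the residue field. If c lies in 𝔭 the matrix is in I;
otherwise c is a unit and the matrix lies in (x, 1; 1, 0)I with x ≡ a/c modulo 𝔭. -/
lemma imageModCenter_maximalCompact (q : GL2ModCenter F) :
    q ∈ imageModCenter (maximalCompact F) ↔
      q ∈ iwahoriBar F ∨ ∃ x ∈ reps F 1, (pt x 1 * omBar F)⁻¹ * q ∈ iwahoriBar F := by
  constructor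
  · rintro ⟨k, ⟨h1, h2⟩, rfl⟩
    rw [Matrix.det_fin_two] at h2
    rcases lt_or_eq_of_le (h1 1 0) with hc | hc
    · left
      have hbc : valuation F (k.1 0 1 * k.1 1 0) < 1 := by
        rw [map_mul]; exact (mul_le_of_le_one_left' (h1 0 1)).trans_lt hc
      have had : valuation F (k.1 0 0 * k.1 1 1) = 1 := by
        rw [show k.1 0 0 * k.1 1 1 = (k.1 0 0 * k.1 1 1 - k.1 0 1 * k.1 1 0) +
          k.1 0 1 * k.1 1 0 by ring, Valuation.map_add_eq_of_lt_left, h2]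
        rwa [h2]
      rw [map_mul] at had
      have ha : valuation F (k.1 0 0) = 1 := le_antisymm (h1 0 0) (by
        rw [← had]; exact mul_le_of_le_one_right' (h1 1 1))
      rw [ha, one_mul] at had
      exact ⟨k, ⟨ha, had, h1 0 1, hc⟩, rfl⟩
    · right
      have hc0 : k.1 1 0 ≠ 0 := by
        intro h; rw [h, map_zero] at hc; exact zero_ne_one hc
      obtain ⟨x, ⟨hx, hxy⟩, -⟩ := existsUnique_mem_reps (y := k.1 0 0 / k.1 1 0) 1 (by
        rw [map_div₀, hc, div_one]; exact h1 0 0)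
      refine ⟨x, hx, ?_⟩
      have hax : valuation F (x * k.1 1 0 - k.1 0 0) < 1 := by
        rw [pow_one, valuation_le_unif_iff, show k.1 0 0 / k.1 1 0 - x =
          -(x * k.1 1 0 - k.1 0 0) / k.1 1 0 by field_simp; ring, map_div₀, Valuation.map_neg, hc,
          div_one] at hxy
        exact hxy
      have hxb : valuation F (x * k.1 1 1 - k.1 0 1) = 1 := by
        have : valuation F (k.1 1 0 * (x * k.1 1 1 - k.1 0 1)) = 1 := by
          rw [show k.1 1 0 * (x * k.1 1 1 - k.1 0 1) = k.1 1 1 * (x * k.1 1 0 - k.1 0 0) +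
            (k.1 0 0 * k.1 1 1 - k.1 0 1 * k.1 1 0) by ring, Valuation.map_add_eq_of_lt_right, h2]
          rw [h2, map_mul]
          exact (mul_le_of_le_one_left' (h1 1 1)).trans_lt hax
        rwa [map_mul, hc, one_mul] at this
      rw [mk_uni_mul_dia_one_mul_om, mk_inv_mul_mk_mem_iwahoriBar_iff]
      simp only [val_mat, Matrix.of_apply, Matrix.cons_val', Matrix.cons_val_zero,
        Matrix.cons_val_one, Matrix.cons_val_fin_one, zero_mul, zero_sub, one_mul,
        Valuation.map_neg, hc, hxb, true_and]
      exact ⟨h1 1 1, hax⟩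
  · rintro (⟨k, ⟨h1, h2, h3, h4⟩, rfl⟩ | ⟨x, hx, k, ⟨h1, h2, h3, h4⟩, hk⟩)
    · refine ⟨k, ⟨?_, ?_⟩, rfl⟩
      · intro i j; fin_cases i <;> fin_cases j
        exacts [h1.le, h3, h4.le, h2.le]
      · rw [Matrix.det_fin_two, Valuation.map_sub_eq_of_lt_left, map_mul, h1, h2, one_mul]
        rw [map_mul, map_mul, h1, h2, one_mul]
        exact (mul_le_of_le_one_left' h3).trans_lt h4
    · have hx1 := valuation_le_one_of_mem_reps hx
      refine ⟨mat x 1 1 0 (by simp) * k, ⟨?_, ?_⟩, ?_⟩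
      · intro i j
        have hk (i j : Fin 2) : valuation F (k.1 i j) ≤ 1 := by
          fin_cases i <;> fin_cases j
          exacts [h1.le, h3, h4.le, h2.le]
        rw [Units.val_mul, Matrix.mul_apply, Fin.sum_univ_two]
        refine (valuation F).map_add_le ?_ ?_ <;> rw [map_mul] <;>
          refine mul_le_one' ?_ (hk _ _) <;> fin_cases i <;> simp [hx1]
      · rw [Units.val_mul, Matrix.det_mul, map_mul, val_mat, Matrix.det_fin_two_of,
          Matrix.det_fin_two, Valuation.map_sub_eq_of_lt_left (x := k.1 0 0 * k.1 1 1)]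
        · simp [h1, h2]
        · rw [map_mul, map_mul, h1, h2, one_mul]
          exact (mul_le_of_le_one_left' h3).trans_lt h4
      · rw [QuotientGroup.mk_mul, ← mk_uni_mul_dia_one_mul_om]
        change _ * QuotientGroup.mk' _ k = q
        rw [hk, mul_inv_cancel_left]

open scoped Pointwise in
lemma measure_maximalCompact [MeasurableSpace (GL2ModCenter F)] [BorelSpace (GL2ModCenter F)]
    (μ : Measure (GL2ModCenter F)) [μ.IsHaarMeasure] :
    μ (imageModCenter (maximalCompact F)) = (resCard F + 1) * μ (iwahoriBar F) := by
  let s (x : F) : Set (GL2ModCenter F) := (pt x 1 * omBar F) • (iwahoriBar F : Set (GL2ModCenter F))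
  have hs (x) (q) : q ∈ s x ↔ (pt x 1 * omBar F)⁻¹ * q ∈ iwahoriBar F := by
    simp [s, Set.mem_smul_set_iff_inv_smul_mem]
  have hm (x) : MeasurableSet (s x) := (isOpen_iwahoriBar.smul (pt x 1 * omBar F)).measurableSet
  have hK : imageModCenter (maximalCompact F) =
      (iwahoriBar F : Set (GL2ModCenter F)) ∪ ⋃ x ∈ reps F 1, s x := by
    ext q
    rw [imageModCenter_maximalCompact]
    simp [hs]
  -- Viewing the trivial coset as that of `pt 0 0` lets the separation of cosets with and without ω
  -- apply.
  have hpt : (pt 0 0 : GL2ModCenter F) = 1 := by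
    rw [pt, ← QuotientGroup.mk_one]
    congr 1
    rw [uni_mul_dia]
    apply Units.ext
    ext i j; fin_cases i <;> fin_cases j <;> simp
  have hd1 : Disjoint (iwahoriBar F : Set (GL2ModCenter F)) (⋃ x ∈ reps F 1, s x) := by
    refine Set.disjoint_left.2 fun q hq hq' => ?_
    simp only [Set.mem_iUnion] at hq'
    obtain ⟨x, -, hx⟩ := hq'
    rw [hs] at hx
    refine pt_inv_mul_pt_mul_omBar_notMem (x := (0 : F)) (y := x) (m := 0) (n := 1) ?_
    have := mul_mem hq (inv_mem hx)
    rwa [mul_inv_rev, inv_inv, mul_inv_cancel_left, ← one_mul (pt x 1 * omBar F), ← inv_one,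
      ← hpt] at this
  have hd2 : (reps F 1 : Set F).PairwiseDisjoint s := by
    intro x hx y hy hxy
    refine Set.disjoint_left.2 fun q hq hq' => hxy (eq_of_mem_reps hx hy ?_)
    rw [hs] at hq hq'
    refine (pt_inv_mul_pt_mem_iff (m := 1) (n := 1).1 ?_).2
    have := mul_mem hq (inv_mem hq')
    rw [← omBar_conj_mem_iff]
    rw [← omBar_inv]
    convert this using 1
    rw [omBar_inv]; simp [mul_assoc, omBar_inv]
  rw [hK, measure_union hd1 (Finset.measurableSet_biUnion _ fun x _ => hm x),
    measure_biUnion_finset hd2 fun x _ => hm x]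
  simp only [s, measure_smul, Finset.sum_const, card_reps, pow_one, nsmul_eq_mul]
  ring

end MaximalCompact

end GL2Steinberg

end

open GL2Steinberg in
theorem proposition13p2 (F : Type*) [Field F] [ValuativeRel F] [TopologicalSpace F]
    [IsNonarchimedeanLocalField F]
    [MeasurableSpace (GL2ModCenter F)] [BorelSpace (GL2ModCenter F)]
    (μ : Measure (GL2ModCenter F)) [μ.IsHaarMeasure] :
    (μ (imageModCenter (iwahori F)) = 1 →
      ∀ d : ℝ, IsFormalDimension (steinberg F) μ d ↔
        d = ((Nat.card 𝓀[F] : ℝ) - 1) / (2 * ((Nat.card 𝓀[F] : ℝ) + 1))) ∧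
    (μ (imageModCenter (maximalCompact F)) = 1 →
      ∀ d : ℝ, IsFormalDimension (steinberg F) μ d ↔
        d = ((Nat.card 𝓀[F] : ℝ) - 1) / 2) := by
  have hq : (1 : ℝ) < Nat.card 𝓀[F] := by exact_mod_cast one_lt_resCard F
  have hq1 : (Nat.card 𝓀[F] : ℝ) - 1 ≠ 0 := by linarith
  have hq2 : (Nat.card 𝓀[F] : ℝ) + 1 ≠ 0 := by linarith
  refine ⟨fun h d => ?_, fun h d => ?_⟩ <;> rw [isFormalDimension_steinberg_iff, resCard]
  · rw [← coe_iwahoriBar] at h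
    rw [Measure.real, h, ENNReal.toReal_one, one_mul, inv_div]
  · rw [measure_maximalCompact] at h
    have h2 := congrArg ENNReal.toReal h
    rw [ENNReal.toReal_mul, ENNReal.toReal_add (by simp) (by simp), ENNReal.toReal_natCast,
      ENNReal.toReal_one, resCard] at h2
    -- The index q + 1 of I in K cancels the factor q + 1 of the orthogonality constant.
    have h3 : μ.real (iwahoriBar F) = ((Nat.card 𝓀[F] : ℝ) + 1)⁻¹ := eq_inv_of_mul_eq_one_right h2
    rw [h3]
    congr! 1
    field_simp
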